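/- Theorem 2.1. Let $\eta_{i,j}$ $(i,j\in\mathbb N)$ be i.i.d. real random variables with $\mathbf E\,\eta_{i,j}=0$ and $\mathbf E\,e^{t\eta_{i,j}}<\infty$ for some $t>0$ (hence for all $t$ in an interval $I=[0,t_0]$, $t_0>0$). Put $\varphi(t)=\log\mathbf E\,e^{t\eta_{i,j}}\in(-\infty,+\infty]$ and $\phi(x)=\sup_{t\ge0}\{xt-\varphi(t)\}$. Let $\lambda_i^{(m)}$ $(i,m\in\mathbb N)$ be independent random variables with values in $\{0,1,2,\dots\}$, independent of the family $\{\eta_{i,j}\}$, with laws not depending on $i$, with $\mathbf E\,\lambda_i^{(m)}=m$, and such that for some function $\chi:[0,\infty)\to\mathbb R$, differentiable on $(0,\infty)$, $$\mathbf E\,e^{t\lambda_i^{(m)}}=e^{m\chi(t)(1+o(1))}\quad\text{as } m\to\infty,\qquad\text{for every } t\ge0.$$ Put $\psi(s)=\sup_{t\ge0}\{st-\chi(t)\}$ and, for real $x$, $$\nu(x)=\inf_{y>0}\Big[\psi(y)+y\,\phi\Big(\frac xy\Big)\Big]$$ (these functions take values in $[0,+\infty]$). Let $\beta>0$, $q>0$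 and $N_q=\lfloor e^{qm}\rfloor$. Then the infimum below is finite and, with probability one, $$\lim_{m\to\infty}\frac1{\beta m}\log\Big(\frac1{N_q}\sum_{i=1}^{N_q}\prod_{j=1}^{\lambda_i^{(m)}}e^{\beta\eta_{i,j}}\Big)=-\frac1\beta\inf_{x\in\mathbb R,\ \nu(x)\le q}\{\nu(x)-\beta x\}.$$ -/

import Mathlib

open MeasureTheory ProbabilityTheory Filter Topology

/-- The Cramér transform `φ(x) = sup_{t ≥ 0} (x t - log E e^{tX})` of a random variable `X`. Values
of `t` with `E e^{tX} = ∞` contribute `-∞` to the supremum, so it is taken over the `t ≥ 0` at which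
the exponential moment is finite. -/
noncomputable def cramerTransform {Ω : Type*} [MeasurableSpace Ω] (μ : Measure Ω) (X : Ω → ℝ)
    (x : ℝ) : EReal :=
  ⨆ t ∈ {t : ℝ | 0 ≤ t ∧ t ∈ integrableExpSet X μ}, ((x * t - cgf X μ t : ℝ) : EReal)

/-- The one-sided Legendre transform `ψ(s) = sup_{t ≥ 0} (s t - χ(t))`, with values in the extended
reals. -/
noncomputable def legendreTransform (χ : ℝ → ℝ) (s : ℝ) : EReal :=
  ⨆ t ∈ Set.Ici (0 : ℝ), ((s * t - χ t : ℝ) : EReal)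

/-- `ν(x) = inf_y [ψ(y) + y φ(x / y)]`. The infimum is over `y > 0`, since the bracket has no literal
meaning at `y = 0`. Read there as its limit for `y ↓ 0` (or as `+∞` for `x > 0`) it does not change
the infimum: for the `φ` and `ψ` at hand `ψ` vanishes at `0` and at `1`, and `y φ(x / y)` is
nonincreasing in `y > 0`. -/
noncomputable def rateFunction (ψ φ : ℝ → EReal) (x : ℝ) : EReal :=
  ⨅ y ∈ Set.Ioi (0 : ℝ), (ψ y + (y : EReal) * φ (x / y))

/-- `inf {ν(x) - β x : ν(x) ≤ q}`, the infimum being over real `x`. -/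
noncomputable def constrainedInf (ν : ℝ → EReal) (β q : ℝ) : EReal :=
  ⨅ x ∈ {x : ℝ | ν x ≤ (q : EReal)}, (ν x - ((β * x : ℝ) : EReal))

/-- The normalized sum of random products
`(1 / N) ∑_{i < N} ∏_{j < lam i m} exp (β η i j)` (indices start at `0`). -/
noncomputable def normalizedSum {Ω : Type*} (η : ℕ → ℕ → Ω → ℝ) (lam : ℕ → ℕ → Ω → ℕ)
    (β : ℝ) (N m : ℕ) (ω : Ω) : ℝ :=
  (1 / (N : ℝ)) * ∑ i ∈ Finset.range N, ∏ j ∈ Finset.range (lam i m ω), Real.exp (β * η i j ω)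

/-- `E e^{t L m} = e^{m χ(t) (1 + o(1))}` as `m → ∞`, for every `t ≥ 0`. The expectation is a Lebesgue
integral in `[0, ∞]`, so its finiteness for large `m` is part of the condition. -/
def HasExponentialAsymptotics {Ω : Type*} [MeasurableSpace Ω] (μ : Measure Ω) (L : ℕ → Ω → ℕ)
    (χ : ℝ → ℝ) : Prop :=
  ∀ t : ℝ, 0 ≤ t → ∃ ε : ℕ → ℝ, Tendsto ε atTop (𝓝 0) ∧
    ∀ᶠ m : ℕ in atTop, ∫⁻ ω, ENNReal.ofReal (Real.exp (t * (L m ω : ℝ))) ∂μ =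
      ENNReal.ofReal (Real.exp ((m : ℝ) * χ t * (1 + ε m)))

/-! Let `φ` be the cumulant generating function of `η 0 0`, let `S_i` be the sum of the first `lam i
m` variables `η i j`, and put `Λ = χ ∘ φ`. Conditioning on `lam` gives `E e^{t S_i} = E e^{φ(t) lam}
= e^{m (Λ(t) + o(1))}` wherever `φ(t)` is finite; mean zero gives `φ ≥ 0`, so `χ` is only used on
`[0, ∞)`. What remains is a random energy model with `e^{qm}` pairwise independent levels. Both
sides of the theorem are compared with `G = inf_{0 < t ≤ β} [(β / t) (q + Λ(t)) - q]`: the logarithm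
of the normalized sum is `m (G + o(1))`, and the constrained infimum is `-G`.

Upper bound on the sum (`ae_eventually_log_sum_le`): Markov and Borel–Cantelli bound `∑ e^{t S_i}`
by `e^{m (q + Λ(t) + ε)}`. This also bounds every single `S_i`, and `e^{β S_i} = e^{t S_i} e^{(β -
t) S_i}`.

Lower bound (`ae_eventually_le_log_sum`): with `x = Λ'(t)` and `I = t x - Λ(t)`, tilting gives
`P(S_i ≥ (x - δ) m) ≥ e^{-m (I + o(1))}`. If `I < q`, Chebyshev makes about `e^{m (q - I)}` indices
reach this level, contributing `β x - I` to the exponent. By `exists_minimum_div_add`, at a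
minimiser of `(β / t) (q + Λ(t)) - q` one has `I ≤ q`, and `β x - I` is the minimum itself.

The infimum `G` may be approached where `φ` has no derivative, at the end of its domain of
finiteness. So `η` is replaced by `min η M`, whose transform is finite and smooth for `t > 0`; this
only lowers the sums, and compactness recovers `G` as `M → ∞` (`exists_truncation_near_sInf`). For
the variational side, `ν(x) ≥ t x - Λ(t)` always, and the reverse inequality, with `Λ` truncated,
holds at the tangent slopes `x` (`rateFunction_le_of_truncation`). -/

/-! ### Jensen's inequality and convexity for cumulant generating functions. -/

section CumulantGeneratingFunction

variable {Ω : Type*} [MeasurableSpace Ω] {μ : Measure Ω} {X : Ω → ℝ} {t : ℝ}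

/-- The density of the exponential tilt has total mass one. Pointwise inequalities for `exp`,
integrated against this normalization, give the next three lemmas. -/
lemma integral_exp_mul_sub_cgf [IsProbabilityMeasure μ] (ht : t ∈ integrableExpSet X μ) :
    Integrable (fun ω => Real.exp (t * X ω - cgf X μ t)) μ ∧
      ∫ ω, Real.exp (t * X ω - cgf X μ t) ∂μ = 1 := by
  have h : (fun ω => Real.exp (t * X ω - cgf X μ t)) =
      fun ω => Real.exp (t * X ω) * Real.exp (-cgf X μ t) := by
    ext ω; rw [sub_eq_add_neg, Real.exp_add]
  rw [h]
  refine ⟨Integrable.mul_const ht _, ?_⟩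
  rw [integral_mul_const, ← mgf, ← exp_cgf ht, ← Real.exp_add]
  simp

lemma mul_integral_le_cgf [IsProbabilityMeasure μ] (hX : Integrable X μ)
    (ht : t ∈ integrableExpSet X μ) : t * ∫ ω, X ω ∂μ ≤ cgf X μ t := by
  obtain ⟨h1, h2⟩ := integral_exp_mul_sub_cgf ht
  have h3 : ∫ ω, (t * X ω + (1 - cgf X μ t)) ∂μ ≤ ∫ ω, Real.exp (t * X ω - cgf X μ t) ∂μ := by
    refine integral_mono ((hX.const_mul t).add (integrable_const _)) h1 fun ω => ?_
    have := Real.add_one_le_exp (t * X ω - cgf X μ t)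
    simp only
    linarith
  rw [integral_add (hX.const_mul t) (integrable_const _), integral_const_mul, h2] at h3
  simp at h3
  linarith

/-- Equality case of Jensen: `e^u - (u + 1)` is nonnegative with zero integral, and vanishes only at
`u = 0`. -/
lemma ae_eq_zero_of_cgf_eq_zero [IsProbabilityMeasure μ] (hX : Integrable X μ)
    (h0 : ∫ ω, X ω ∂μ = 0) (ht : t ∈ integrableExpSet X μ) (htne : t ≠ 0)
    (hc : cgf X μ t = 0) : X =ᵐ[μ] 0 := by
  obtain ⟨h1, h2⟩ := integral_exp_mul_sub_cgf ht
  simp only [hc, sub_zero] at h1 h2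
  have hlin : Integrable (fun ω => t * X ω + 1) μ := (hX.const_mul t).add (integrable_const _)
  have h3 : ∫ ω, (Real.exp (t * X ω) - (t * X ω + 1)) ∂μ = 0 := by
    rw [integral_sub h1 hlin,
      integral_add (hX.const_mul t) (integrable_const _), integral_const_mul, h2, h0]
    simp
  rw [integral_eq_zero_iff_of_nonneg
    (fun ω => sub_nonneg.2 (Real.add_one_le_exp (t * X ω)))
    (h1.sub hlin)] at h3
  filter_upwards [h3] with ω hω
  by_contra hne
  have := Real.add_one_lt_exp (mul_ne_zero htne hne)
  simp only [Pi.zero_apply] at hω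
  linarith

lemma convexOn_cgf [IsProbabilityMeasure μ] :
    ConvexOn ℝ (integrableExpSet X μ) (cgf X μ) := by
  refine ⟨convex_integrableExpSet, fun s hs t ht a b ha hb hab => ?_⟩
  have hst : a • s + b • t ∈ integrableExpSet X μ := convex_integrableExpSet hs ht ha hb hab
  simp only [smul_eq_mul] at hst ⊢
  obtain ⟨s1, s2⟩ := integral_exp_mul_sub_cgf hs
  obtain ⟨t1, t2⟩ := integral_exp_mul_sub_cgf ht
  have h3 : ∫ ω, Real.exp ((a * s + b * t) * X ω) * Real.exp (-(a * cgf X μ s + b * cgf X μ t)) ∂μ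
      ≤ ∫ ω, (a * Real.exp (s * X ω - cgf X μ s) + b * Real.exp (t * X ω - cgf X μ t)) ∂μ := by
    refine integral_mono (Integrable.mul_const hst _) ((s1.const_mul a).add (t1.const_mul b))
      fun ω => ?_
    have := convexOn_exp.2 (Set.mem_univ (s * X ω - cgf X μ s))
      (Set.mem_univ (t * X ω - cgf X μ t)) ha hb hab
    simp only [smul_eq_mul] at this
    refine le_trans (le_of_eq ?_) this
    simp only [← Real.exp_add]
    congr 1
    ring
  rw [integral_add (s1.const_mul a) (t1.const_mul b), integral_const_mul, integral_const_mul,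
    s2, t2, integral_mul_const, ← mgf, ← exp_cgf hst, ← Real.exp_add, mul_one, mul_one, hab,
    ← Real.exp_zero, Real.exp_le_exp] at h3
  linarith

/-- `mgf` takes the default value `0` when the integral diverges, so finiteness has to come from the
Lebesgue integral. -/
lemma mem_integrableExpSet_of_lintegral (hX : AEMeasurable X μ) {v : ℝ} (hv : 0 ≤ v)
    (h : ∫⁻ ω, ENNReal.ofReal (Real.exp (t * X ω)) ∂μ = ENNReal.ofReal v) :
    t ∈ integrableExpSet X μ ∧ mgf X μ t = v := by
  have hm : AEStronglyMeasurable (fun ω => Real.exp (t * X ω)) μ :=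
    aemeasurable_exp_mul t hX
  have hint : Integrable (fun ω => Real.exp (t * X ω)) μ := by
    refine ⟨hm, ?_⟩
    rw [hasFiniteIntegral_iff_ofReal (Eventually.of_forall fun ω => (Real.exp_pos _).le), h]
    exact ENNReal.ofReal_lt_top
  refine ⟨hint, ?_⟩
  rw [mgf, integral_eq_lintegral_of_nonneg_ae
    (Eventually.of_forall fun ω => (Real.exp_pos _).le) hm, h, ENNReal.toReal_ofReal hv]

lemma lintegral_exp_mul_eq [NeZero μ] (ht : t ∈ integrableExpSet X μ) :
    ∫⁻ ω, ENNReal.ofReal (Real.exp (t * X ω)) ∂μ = ENNReal.ofReal (Real.exp (cgf X μ t)) := by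
  rw [exp_cgf ht, mgf, ofReal_integral_eq_lintegral_ofReal ht
    (Eventually.of_forall fun ω => (Real.exp_pos _).le)]

lemma mem_integrableExpSet_of_le [IsFiniteMeasure μ] {s : ℝ}
    (hs : 0 ≤ s) (hst : s ≤ t) (ht : t ∈ integrableExpSet X μ) : s ∈ integrableExpSet X μ :=
  integrable_exp_mul_of_nonneg_of_le ht hs hst

end CumulantGeneratingFunction

lemma ConvexOn.add_mul_sub_le {S : Set ℝ} {f : ℝ → ℝ} {x y f' : ℝ} (hf : ConvexOn ℝ S f)
    (hx : x ∈ S) (hy : y ∈ S) (hd : HasDerivAt f f' x) : f x + f' * (y - x) ≤ f y := by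
  rcases lt_trichotomy x y with h | h | h
  · have := hf.le_slope_of_hasDerivAt hx hy h hd
    rw [slope_def_field, le_div_iff₀ (by linarith)] at this
    linarith
  · simp [h]
  · have := hf.slope_le_of_hasDerivAt hy hx h hd
    rw [slope_def_field, div_le_iff₀ (by linarith)] at this
    linarith

/-! ### Truncation from above and its limit. -/

section Truncation

variable {Ω : Type*} [MeasurableSpace Ω] {μ : Measure Ω} {X : Ω → ℝ}

lemma tendsto_lintegral_exp_mul_min (hX : AEMeasurable X μ) {t : ℝ} (ht : 0 ≤ t) :
    Tendsto (fun n : ℕ => ∫⁻ ω, ENNReal.ofReal (Real.exp (t * min (X ω) n)) ∂μ) atTop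
      (𝓝 (∫⁻ ω, ENNReal.ofReal (Real.exp (t * X ω)) ∂μ)) := by
  refine lintegral_tendsto_of_tendsto_of_monotone (fun n => by fun_prop)
    (Eventually.of_forall fun ω m n hmn => ?_) (Eventually.of_forall fun ω => ?_)
  · refine ENNReal.ofReal_le_ofReal (Real.exp_le_exp.2 (mul_le_mul_of_nonneg_left ?_ ht))
    exact min_le_min_left _ (Nat.cast_le.2 hmn)
  · refine tendsto_const_nhds.congr' ?_
    filter_upwards [eventually_ge_atTop ⌈X ω⌉₊] with n hn
    rw [min_eq_left (Nat.ceil_le.1 hn)]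

variable [IsProbabilityMeasure μ]

lemma mem_integrableExpSet_min (hX : AEMeasurable X μ) (M : ℝ) {t : ℝ} (ht : 0 ≤ t) :
    t ∈ integrableExpSet (fun ω => min (X ω) M) μ :=
  integrable_exp_mul_of_le t M ht (hX.min aemeasurable_const)
    (Eventually.of_forall fun _ => min_le_right _ _)

/-- The gain from truncating: all nonnegative exponential moments are finite, so every `t > 0` is
interior to the domain of finiteness. -/
lemma differentiableAt_cgf_min (hX : AEMeasurable X μ) (M : ℝ) {t : ℝ} (ht : 0 < t) :
    DifferentiableAt ℝ (cgf (fun ω => min (X ω) M) μ) t := by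
  refine (analyticAt_cgf ?_).differentiableAt
  rw [mem_interior_iff_mem_nhds]
  exact mem_of_superset (Ioi_mem_nhds ht) fun s hs =>
    mem_integrableExpSet_min hX M (le_of_lt hs)

lemma cgf_min_mono (hX : AEMeasurable X μ) {M M' : ℝ} (h : M ≤ M') {t : ℝ} (ht : 0 ≤ t) :
    cgf (fun ω => min (X ω) M) μ t ≤ cgf (fun ω => min (X ω) M') μ t := by
  refine Real.log_le_log (mgf_pos (mem_integrableExpSet_min hX M ht)) ?_
  exact mgf_mono_of_nonneg (Eventually.of_forall fun ω => min_le_min_left _ h) ht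
    (mem_integrableExpSet_min hX M' ht)

lemma cgf_min_le (hX : AEMeasurable X μ) (M : ℝ) {t : ℝ} (ht : 0 ≤ t)
    (h : t ∈ integrableExpSet X μ) : cgf (fun ω => min (X ω) M) μ t ≤ cgf X μ t := by
  refine Real.log_le_log (mgf_pos (mem_integrableExpSet_min hX M ht)) ?_
  exact mgf_mono_of_nonneg (Eventually.of_forall fun ω => min_le_left _ _) ht h

lemma tendsto_cgf_min (hX : AEMeasurable X μ) {t : ℝ} (ht : 0 ≤ t)
    (h : t ∈ integrableExpSet X μ) :
    Tendsto (fun n : ℕ => cgf (fun ω => min (X ω) n) μ t) atTop (𝓝 (cgf X μ t)) := by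
  have h1 := tendsto_lintegral_exp_mul_min hX ht
  rw [lintegral_exp_mul_eq h] at h1
  have h2 := (ENNReal.tendsto_toReal ENNReal.ofReal_ne_top).comp h1
  rw [ENNReal.toReal_ofReal (Real.exp_pos _).le] at h2
  have h3 := h2.log (Real.exp_pos _).ne'
  rw [Real.log_exp] at h3
  refine h3.congr fun n => ?_
  have := lintegral_exp_mul_eq (mem_integrableExpSet_min hX n ht)
  simp only [Function.comp_apply]
  rw [this, ENNReal.toReal_ofReal (Real.exp_pos _).le, Real.log_exp]

/-- Monotone convergence passes the uniform bound to the limit. This places the limit point of the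
compactness argument inside the domain of finiteness. -/
lemma mem_integrableExpSet_of_cgf_min_le (hX : AEMeasurable X μ) {t : ℝ} (ht : 0 ≤ t) {C : ℝ}
    (h : ∀ n : ℕ, cgf (fun ω => min (X ω) n) μ t ≤ C) : t ∈ integrableExpSet X μ := by
  have h1 : ∫⁻ ω, ENNReal.ofReal (Real.exp (t * X ω)) ∂μ ≤ ENNReal.ofReal (Real.exp C) := by
    refine le_of_tendsto' (tendsto_lintegral_exp_mul_min hX ht) fun n => ?_
    rw [lintegral_exp_mul_eq (mem_integrableExpSet_min hX n ht)]
    exact ENNReal.ofReal_le_ofReal (Real.exp_le_exp.2 (h n))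
  have h2 := ENNReal.ofReal_toReal (h1.trans_lt ENNReal.ofReal_lt_top).ne
  exact (mem_integrableExpSet_of_lintegral hX ENNReal.toReal_nonneg h2.symm).1

end Truncation

/-! ### Properties that `χ` inherits as the limit of normalized cumulant generating functions. -/

section ExponentialAsymptotics

variable {Ω : Type*} [MeasurableSpace Ω] {μ : Measure Ω}
  {L : ℕ → Ω → ℕ} {χ : ℝ → ℝ}

lemma HasExponentialAsymptotics.exists_tendsto (h : HasExponentialAsymptotics μ L χ) {t : ℝ}
    (ht : 0 ≤ t) : ∃ r : ℕ → ℝ, Tendsto r atTop (𝓝 (χ t)) ∧ ∀ᶠ m : ℕ in atTop,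
      ∫⁻ ω, ENNReal.ofReal (Real.exp (t * (L m ω : ℝ))) ∂μ =
        ENNReal.ofReal (Real.exp ((m : ℝ) * r m)) := by
  obtain ⟨ε, hε, h⟩ := h t ht
  refine ⟨fun m => χ t * (1 + ε m), ?_, ?_⟩
  · simpa using (hε.const_add 1).const_mul (χ t)
  · filter_upwards [h] with m hm
    rw [hm, mul_assoc]

lemma HasExponentialAsymptotics.tendsto_cgf (h : HasExponentialAsymptotics μ L χ)
    (hL : ∀ m, Measurable (L m)) {t : ℝ} (ht : 0 ≤ t) :
    (∀ᶠ m in atTop, t ∈ integrableExpSet (fun ω => (L m ω : ℝ)) μ) ∧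
      Tendsto (fun m : ℕ => cgf (fun ω => (L m ω : ℝ)) μ t / m) atTop (𝓝 (χ t)) := by
  obtain ⟨r, hr, h⟩ := h.exists_tendsto ht
  have key : ∀ᶠ m : ℕ in atTop, t ∈ integrableExpSet (fun ω => (L m ω : ℝ)) μ ∧
      mgf (fun ω => (L m ω : ℝ)) μ t = Real.exp (m * r m) := by
    filter_upwards [h] with m hm
    exact mem_integrableExpSet_of_lintegral
      (measurable_from_top.comp (hL m)).aemeasurable (Real.exp_pos _).le hm
  refine ⟨key.mono fun m hm => hm.1, hr.congr' ?_⟩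
  filter_upwards [key, eventually_gt_atTop 0] with m hm hm0
  have : (m : ℝ) ≠ 0 := by positivity
  rw [cgf, hm.2, Real.log_exp]
  field_simp

variable [IsProbabilityMeasure μ]

lemma HasExponentialAsymptotics.apply_zero (h : HasExponentialAsymptotics μ L χ)
    (hL : ∀ m, Measurable (L m)) : χ 0 = 0 := by
  refine tendsto_nhds_unique (h.tendsto_cgf hL le_rfl).2 ?_
  simp [cgf_zero]

lemma HasExponentialAsymptotics.le_apply (h : HasExponentialAsymptotics μ L χ)
    (hL : ∀ m, Measurable (L m)) (hint : ∀ m, Integrable (fun ω => (L m ω : ℝ)) μ)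
    (hmean : ∀ m, ∫ ω, (L m ω : ℝ) ∂μ = (m : ℝ)) {t : ℝ} (ht : 0 ≤ t) : t ≤ χ t := by
  obtain ⟨h1, h2⟩ := h.tendsto_cgf hL ht
  refine ge_of_tendsto h2 ?_
  filter_upwards [h1, eventually_gt_atTop 0] with m hm hm0
  have := mul_integral_le_cgf (hint m) hm
  rw [hmean] at this
  rwa [le_div_iff₀ (by positivity)]

lemma HasExponentialAsymptotics.mono (h : HasExponentialAsymptotics μ L χ)
    (hL : ∀ m, Measurable (L m)) {s t : ℝ} (hs : 0 ≤ s) (hst : s ≤ t) : χ s ≤ χ t := by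
  obtain ⟨hs1, hs2⟩ := h.tendsto_cgf hL hs
  obtain ⟨ht1, ht2⟩ := h.tendsto_cgf hL (hs.trans hst)
  refine le_of_tendsto_of_tendsto hs2 ht2 ?_
  filter_upwards [hs1, ht1] with m hms hmt
  refine div_le_div_of_nonneg_right (Real.log_le_log (mgf_pos hms) ?_) (Nat.cast_nonneg m)
  refine integral_mono hms hmt fun ω => Real.exp_le_exp.2 ?_
  exact mul_le_mul_of_nonneg_right hst (Nat.cast_nonneg _)

lemma HasExponentialAsymptotics.convexOn (h : HasExponentialAsymptotics μ L χ)
    (hL : ∀ m, Measurable (L m)) : ConvexOn ℝ (Set.Ici 0) χ := by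
  refine ⟨convex_Ici 0, fun s hs t ht a b ha hb hab => ?_⟩
  have hst : 0 ≤ a • s + b • t := convex_Ici (0 : ℝ) hs ht ha hb hab
  obtain ⟨hs1, hs2⟩ := h.tendsto_cgf hL hs
  obtain ⟨ht1, ht2⟩ := h.tendsto_cgf hL ht
  refine le_of_tendsto_of_tendsto (h.tendsto_cgf hL hst).2
    ((hs2.const_mul a).add (ht2.const_mul b)) ?_
  filter_upwards [hs1, ht1] with m hms hmt
  have := convexOn_cgf.2 hms hmt ha hb hab
  simp only [smul_eq_mul] at this ⊢
  refine (div_le_div_of_nonneg_right this (Nat.cast_nonneg m)).trans (le_of_eq ?_)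
  ring

end ExponentialAsymptotics

/-! ### Random sums: exponential moments and pairwise independence. -/

/-- The random sum `∑_{j < lam i m} f (η i j)`. -/
noncomputable def randomSum {Ω : Type*} (f : ℝ → ℝ) (η : ℕ → ℕ → Ω → ℝ) (lam : ℕ → ℕ → Ω → ℕ)
    (i m : ℕ) (ω : Ω) : ℝ :=
  ∑ j ∈ Finset.range (lam i m ω), f (η i j ω)

/-- Fubini for the product law, that is, conditioning on `V`. -/
lemma lintegral_comp_of_indepFun {Ω α β : Type*} [MeasurableSpace Ω] [MeasurableSpace α]
    [MeasurableSpace β] {μ : Measure Ω} [IsProbabilityMeasure μ] {U : Ω → α} {V : Ω → β}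
    (hU : Measurable U) (hV : Measurable V) (h : IndepFun U V μ) {F : α × β → ENNReal}
    (hF : Measurable F) :
    ∫⁻ ω, F (U ω, V ω) ∂μ = ∫⁻ ω, ∫⁻ ω', F (U ω', V ω) ∂μ ∂μ := by
  have h1 := (indepFun_iff_map_prod_eq_prod_map_map hU.aemeasurable hV.aemeasurable).1 h
  have := Measure.isProbabilityMeasure_map (μ := μ) hU.aemeasurable
  have := Measure.isProbabilityMeasure_map (μ := μ) hV.aemeasurable
  rw [← lintegral_map hF (hU.prodMk hV), h1, lintegral_prod_symm' _ hF,
    lintegral_map (hF.lintegral_prod_left') hV]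
  refine lintegral_congr fun ω => ?_
  exact lintegral_map (hF.comp measurable_prodMk_right) hU

section RandomSum

variable {Ω : Type*} [MeasurableSpace Ω] {μ : Measure Ω}
  {η : ℕ → ℕ → Ω → ℝ} {lam : ℕ → ℕ → Ω → ℕ} {f : ℝ → ℝ}

lemma measurable_sum_range (hf : Measurable f) (i m : ℕ) :
    Measurable fun p : (ℕ × ℕ → ℝ) × (ℕ × ℕ → ℕ) =>
      ∑ j ∈ Finset.range (p.2 (i, m)), f (p.1 (i, j)) := by
  have h1 : Measurable fun p : (ℕ × ℕ → ℝ) × ℕ => ∑ j ∈ Finset.range p.2, f (p.1 (i, j)) :=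
    measurable_from_prod_countable_left fun n =>
      Finset.measurable_sum (f := fun j (u : ℕ × ℕ → ℝ) => f (u (i, j))) (Finset.range n)
        fun j _ => hf.comp (measurable_pi_apply (i, j))
  exact h1.comp (measurable_fst.prodMk ((measurable_pi_apply (i, m)).comp measurable_snd))

lemma measurable_randomSum (hf : Measurable f) (hη : ∀ i j, Measurable (η i j))
    (hlam : ∀ i m, Measurable (lam i m)) (i m : ℕ) : Measurable (randomSum f η lam i m) :=
  (measurable_sum_range hf i m).comp ((measurable_pi_lambda
    (fun ω (p : ℕ × ℕ) => η p.1 p.2 ω) fun p => hη p.1 p.2).prodMk (measurable_pi_lambda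
    (fun ω (p : ℕ × ℕ) => lam p.1 p.2 ω) fun p => hlam p.1 p.2))

variable [IsProbabilityMeasure μ]

lemma lintegral_exp_sum_range (hf : Measurable f) (hη : ∀ i j, Measurable (η i j))
    (hη_indep : iIndepFun (fun p : ℕ × ℕ => η p.1 p.2) μ)
    (hη_ident : ∀ i j, IdentDistrib (η i j) (η 0 0) μ μ) {t : ℝ}
    (ht : t ∈ integrableExpSet (fun ω => f (η 0 0 ω)) μ) (i n : ℕ) :
    ∫⁻ ω, ENNReal.ofReal (Real.exp (t * ∑ j ∈ Finset.range n, f (η i j ω))) ∂μ =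
      ENNReal.ofReal (Real.exp (cgf (fun ω => f (η 0 0 ω)) μ t * n)) := by
  have hindep : iIndepFun (fun j ω => f (η i j ω)) μ :=
    (hη_indep.precomp (g := fun j : ℕ => (i, j)) (fun a b h => (Prod.mk.inj h).2)).comp
      (fun _ => f) fun _ => hf
  have hmeas : ∀ j, Measurable fun ω => f (η i j ω) := fun j => hf.comp (hη i j)
  have hid : ∀ j, IdentDistrib (fun ω => f (η i j ω)) (fun ω => f (η 0 0 ω)) μ μ :=
    fun j => (hη_ident i j).comp hf
  have hint : ∀ j, t ∈ integrableExpSet (fun ω => f (η i j ω)) μ := fun j =>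
    ((hid j).comp (u := fun x => Real.exp (t * x)) (by fun_prop)).integrable_iff.2 ht
  have h1 : t ∈ integrableExpSet (∑ j ∈ Finset.range n, fun ω => f (η i j ω)) μ :=
    hindep.integrable_exp_mul_sum hmeas fun j _ => hint j
  have h2 := lintegral_exp_mul_eq h1
  simp only [Finset.sum_apply] at h2
  rw [h2, hindep.cgf_sum hmeas fun j _ => hint j]
  congr 2
  rw [Finset.sum_congr rfl fun j _ => ?_, Finset.sum_const, Finset.card_range, nsmul_eq_mul,
    mul_comm]
  rw [cgf, cgf, mgf_congr_identDistrib (hid j)]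

lemma lintegral_exp_randomSum (hf : Measurable f) (hη : ∀ i j, Measurable (η i j))
    (hη_indep : iIndepFun (fun p : ℕ × ℕ => η p.1 p.2) μ)
    (hη_ident : ∀ i j, IdentDistrib (η i j) (η 0 0) μ μ)
    (hlam : ∀ i m, Measurable (lam i m))
    (hlam_ident : ∀ i m, IdentDistrib (lam i m) (lam 0 m) μ μ)
    (h_indep : IndepFun (fun ω (p : ℕ × ℕ) => η p.1 p.2 ω) (fun ω (p : ℕ × ℕ) => lam p.1 p.2 ω) μ)
    {t : ℝ} (ht : t ∈ integrableExpSet (fun ω => f (η 0 0 ω)) μ) (i m : ℕ) :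
    ∫⁻ ω, ENNReal.ofReal (Real.exp (t * randomSum f η lam i m ω)) ∂μ =
      ∫⁻ ω, ENNReal.ofReal (Real.exp (cgf (fun ω => f (η 0 0 ω)) μ t * (lam 0 m ω : ℝ))) ∂μ := by
  have hF : Measurable fun p : (ℕ × ℕ → ℝ) × (ℕ × ℕ → ℕ) => ENNReal.ofReal
      (Real.exp (t * ∑ j ∈ Finset.range (p.2 (i, m)), f (p.1 (i, j)))) :=
    ENNReal.measurable_ofReal.comp
      (Real.measurable_exp.comp ((measurable_sum_range hf i m).const_mul t))
  have h1 := lintegral_comp_of_indepFun (measurable_pi_lambda _ fun p : ℕ × ℕ => hη p.1 p.2)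
    (measurable_pi_lambda _ fun p : ℕ × ℕ => hlam p.1 p.2) h_indep hF
  simp only [randomSum]
  rw [h1]
  simp only [lintegral_exp_sum_range hf hη hη_indep hη_ident ht]
  exact ((hlam_ident i m).comp (u := fun n : ℕ => ENNReal.ofReal
    (Real.exp (cgf (fun ω => f (η 0 0 ω)) μ t * (n : ℝ)))) measurable_from_top).lintegral_eq

/-- With the lengths frozen, the two sums use disjoint rows of `η`. Conditioning on `lam` then
leaves functions of the independent lengths `lam i m` and `lam k m`, so expectations of products
factor. -/
lemma indepFun_randomSum (hf : Measurable f) (hη : ∀ i j, Measurable (η i j))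
    (hη_indep : iIndepFun (fun p : ℕ × ℕ => η p.1 p.2) μ)
    (hlam : ∀ i m, Measurable (lam i m))
    (hlam_indep : iIndepFun (fun p : ℕ × ℕ => lam p.1 p.2) μ)
    (h_indep : IndepFun (fun ω (p : ℕ × ℕ) => η p.1 p.2 ω) (fun ω (p : ℕ × ℕ) => lam p.1 p.2 ω) μ)
    {i k : ℕ} (hik : i ≠ k) (m : ℕ) :
    IndepFun (randomSum f η lam i m) (randomSum f η lam k m) μ := by
  have hsum : ∀ i n, Measurable fun ω => ∑ j ∈ Finset.range n, f (η i j ω) := fun i n =>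
    Finset.measurable_sum _ fun j _ => hf.comp (hη i j)
  have hT : ∀ n n' : ℕ, IndepFun (fun ω => ∑ j ∈ Finset.range n, f (η i j ω))
      (fun ω => ∑ j ∈ Finset.range n', f (η k j ω)) μ := by
    intro n n'
    have hdisj : Disjoint ((Finset.range n).image (Prod.mk i))
        ((Finset.range n').image (Prod.mk k)) := by
      rw [Finset.disjoint_left]
      intro p hp hp'
      simp only [Finset.mem_image] at hp hp'
      obtain ⟨a, -, rfl⟩ := hp
      obtain ⟨b, -, hb⟩ := hp'
      exact hik (Prod.mk.inj hb).1.symm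
    have h1 := hη_indep.indepFun_finset _ _ hdisj fun p => hη p.1 p.2
    have hmeas : ∀ (l n : ℕ), Measurable fun u : ((Finset.range n).image (Prod.mk l)) → ℝ =>
        ∑ p, f (u p) := fun l n => by fun_prop
    have h2 := h1.comp (hmeas i n) (hmeas k n')
    have hsumeq : ∀ (l n : ℕ), ((fun u : ((Finset.range n).image (Prod.mk l)) → ℝ =>
        ∑ p, f (u p)) ∘ fun ω p => η (p : ℕ × ℕ).1 (p : ℕ × ℕ).2 ω) =
        fun ω => ∑ j ∈ Finset.range n, f (η l j ω) := by
      intro l n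
      ext ω
      simp only [Function.comp_apply]
      rw [Finset.sum_coe_sort ((Finset.range n).image (Prod.mk l)) fun p => f (η p.1 p.2 ω),
        Finset.sum_image fun a _ b _ h => (Prod.mk.inj h).2]
    rw [hsumeq, hsumeq] at h2
    exact h2
  have hlam_k : IndepFun (lam i m) (lam k m) μ :=
    hlam_indep.indepFun (i := (i, m)) (j := (k, m)) fun h => hik (Prod.mk.inj h).1
  have hU := measurable_pi_lambda (fun ω (p : ℕ × ℕ) => η p.1 p.2 ω) fun p => hη p.1 p.2
  have hV := measurable_pi_lambda (fun ω (p : ℕ × ℕ) => lam p.1 p.2 ω) fun p => hlam p.1 p.2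
  have hone : ∀ {a : ℝ → ENNReal}, Measurable a → ∀ l, ∫⁻ ω, a (randomSum f η lam l m ω) ∂μ =
      ∫⁻ ω, ∫⁻ ω', a (∑ j ∈ Finset.range (lam l m ω), f (η l j ω')) ∂μ ∂μ := fun ha l =>
    lintegral_comp_of_indepFun hU hV h_indep (ha.comp (measurable_sum_range hf l m))
  have hmul : ∀ {a b : ℝ → ENNReal}, Measurable a → Measurable b →
      ∫⁻ ω, a (randomSum f η lam i m ω) * b (randomSum f η lam k m ω) ∂μ =
      (∫⁻ ω, a (randomSum f η lam i m ω) ∂μ) * ∫⁻ ω, b (randomSum f η lam k m ω) ∂μ := by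
    intro a b ha hb
    have h1 := lintegral_comp_of_indepFun hU hV h_indep
      ((ha.comp (measurable_sum_range hf i m)).mul (hb.comp (measurable_sum_range hf k m)))
    refine h1.trans ?_
    rw [hone ha, hone hb]
    have h2 : ∀ n n' : ℕ, ∫⁻ ω', a (∑ j ∈ Finset.range n, f (η i j ω')) *
        b (∑ j ∈ Finset.range n', f (η k j ω')) ∂μ =
        (∫⁻ ω', a (∑ j ∈ Finset.range n, f (η i j ω')) ∂μ) *
          ∫⁻ ω', b (∑ j ∈ Finset.range n', f (η k j ω')) ∂μ := fun n n' =>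
      lintegral_mul_eq_lintegral_mul_lintegral_of_indepFun (ha.comp (hsum i n))
        (hb.comp (hsum k n')) ((hT n n').comp ha hb)
    refine (lintegral_congr fun ω => h2 (lam i m ω) (lam k m ω)).trans ?_
    exact lintegral_mul_eq_lintegral_mul_lintegral_of_indepFun
      (f := fun ω => ∫⁻ ω', a (∑ j ∈ Finset.range (lam i m ω), f (η i j ω')) ∂μ)
      (g := fun ω => ∫⁻ ω', b (∑ j ∈ Finset.range (lam k m ω), f (η k j ω')) ∂μ)
      ((measurable_from_top (f := fun n =>
        ∫⁻ ω', a (∑ j ∈ Finset.range n, f (η i j ω')) ∂μ)).comp (hlam i m))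
      ((measurable_from_top (f := fun n =>
        ∫⁻ ω', b (∑ j ∈ Finset.range n, f (η k j ω')) ∂μ)).comp (hlam k m))
      (hlam_k.comp (φ := fun n => ∫⁻ ω', a (∑ j ∈ Finset.range n, f (η i j ω')) ∂μ)
        (ψ := fun n => ∫⁻ ω', b (∑ j ∈ Finset.range n, f (η k j ω')) ∂μ)
        measurable_from_top measurable_from_top)
  have hS : ∀ l, Measurable (randomSum f η lam l m) := fun l => measurable_randomSum hf hη hlam l m
  rw [indepFun_iff_measure_inter_preimage_eq_mul]
  intro s t hs ht
  have h3 := hmul (measurable_one.indicator hs) (measurable_one.indicator ht)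
  rw [← lintegral_indicator_one ((hS i hs).inter (hS k ht)), ← lintegral_indicator_one (hS i hs),
    ← lintegral_indicator_one (hS k ht), Set.inter_indicator_one]
  exact h3

end RandomSum

/-! ### Almost sure exponential bounds for sums over `e^{qm}` variables. -/

section LargeDeviations

variable {Ω : Type*} [MeasurableSpace Ω] {μ : Measure Ω}

lemma ae_eventually_notMem_of_le_exp {s : ℕ → Set Ω} {C c : ℝ} (hc : 0 < c)
    (h : ∀ᶠ m : ℕ in atTop, μ (s m) ≤ ENNReal.ofReal (C * Real.exp (-(c * m)))) :
    ∀ᵐ ω ∂μ, ∀ᶠ m in atTop, ω ∉ s m := by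
  obtain ⟨m₀, hm₀⟩ := eventually_atTop.1 h
  have hsum : Summable fun m : ℕ => |C| * Real.exp (-(c * m)) := by
    refine Summable.mul_left _ ?_
    refine (Real.summable_exp_nat_mul_iff.2 (neg_lt_zero.2 hc)).congr fun m => ?_
    congr 1; ring
  have h1 : ∑' m, μ (s (m + m₀)) ≠ ⊤ := by
    refine ne_top_of_le_ne_top ?_ (ENNReal.tsum_le_tsum fun m => (hm₀ (m + m₀) (by omega)).trans
      (ENNReal.ofReal_le_ofReal (mul_le_mul_of_nonneg_right (le_abs_self C)
        (Real.exp_pos _).le)))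
    rw [← ENNReal.ofReal_tsum_of_nonneg (fun m => by positivity)
      ((summable_nat_add_iff (f := fun m : ℕ => |C| * Real.exp (-(c * m))) m₀).2 hsum)]
    exact ENNReal.ofReal_ne_top
  filter_upwards [ae_eventually_notMem h1] with ω hω
  obtain ⟨n, hn⟩ := eventually_atTop.1 hω
  refine eventually_atTop.2 ⟨n + m₀, fun m hm => ?_⟩
  have := hn (m - m₀) (by omega)
  rwa [Nat.sub_add_cancel (by omega)] at this

/-- Exponential tilting at `t`, with the mass away from `[(x - δ) m, (x + δ) m]` controlled by the
moment generating function at `t - h` and `t + h`. -/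
lemma le_measureReal_of_mgf_eq [IsFiniteMeasure μ] {X : Ω → ℝ} (hX : Measurable X)
    {m t h x δ a a₁ a₂ κ : ℝ} (ht : 0 ≤ t) (hh : 0 ≤ h) (hm : 0 ≤ m)
    (hκ : 4 * Real.exp (-(m * κ)) ≤ 1)
    (h0 : t ∈ integrableExpSet X μ) (h1 : t - h ∈ integrableExpSet X μ)
    (h2 : t + h ∈ integrableExpSet X μ)
    (e0 : mgf X μ t = Real.exp (m * a)) (e1 : mgf X μ (t - h) = Real.exp (m * a₁))
    (e2 : mgf X μ (t + h) = Real.exp (m * a₂))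
    (ha₁ : a₁ + h * (x - δ) ≤ a - κ) (ha₂ : a₂ - h * (x + δ) ≤ a - κ) :
    Real.exp (m * (a - t * (x + δ))) / 2 ≤ μ.real {ω | (x - δ) * m ≤ X ω} := by
  set A := {ω | (x - δ) * m ≤ X ω} with hA
  have hAm : MeasurableSet A := measurableSet_le measurable_const hX
  have i1 : Integrable (fun ω => A.indicator (fun _ => Real.exp (t * (x + δ) * m)) ω) μ :=
    (integrable_const _).indicator hAm
  have i2 : Integrable (fun ω => Real.exp ((t - h) * X ω) * Real.exp (h * (x - δ) * m)) μ :=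
    Integrable.mul_const h1 _
  have i3 : Integrable (fun ω => Real.exp ((t + h) * X ω) * Real.exp (-(h * (x + δ) * m))) μ :=
    Integrable.mul_const h2 _
  have hle : ∫ ω, Real.exp (t * X ω) ∂μ ≤
      ∫ ω, (A.indicator (fun _ => Real.exp (t * (x + δ) * m)) ω +
        Real.exp ((t - h) * X ω) * Real.exp (h * (x - δ) * m) +
        Real.exp ((t + h) * X ω) * Real.exp (-(h * (x + δ) * m))) ∂μ := by
    -- Below the window `e^{tX}` is at most the `t - h` term, above it at most the `t + h` term, and
    -- inside it at most the constant under the indicator.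
    refine integral_mono h0 ((i1.add i2).add i3) fun ω => ?_
    simp only [← Real.exp_add]
    have p1 : 0 ≤ A.indicator (fun _ => Real.exp (t * (x + δ) * m)) ω :=
      Set.indicator_nonneg (fun _ _ => (Real.exp_pos _).le) _
    have p2 := Real.exp_pos ((t - h) * X ω + h * (x - δ) * m)
    have p3 := Real.exp_pos ((t + h) * X ω + -(h * (x + δ) * m))
    by_cases hω : (x - δ) * m ≤ X ω
    · by_cases hω' : X ω ≤ (x + δ) * m
      · have : A.indicator (fun _ => Real.exp (t * (x + δ) * m)) ω =
            Real.exp (t * (x + δ) * m) := Set.indicator_of_mem (s := A) (a := ω) hω _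
        have h4 : Real.exp (t * X ω) ≤ Real.exp (t * (x + δ) * m) := by
          rw [Real.exp_le_exp, mul_assoc]
          exact mul_le_mul_of_nonneg_left hω' ht
        linarith
      · have h4 : Real.exp (t * X ω) ≤ Real.exp ((t + h) * X ω + -(h * (x + δ) * m)) := by
          rw [Real.exp_le_exp]
          nlinarith
        linarith
    · have h4 : Real.exp (t * X ω) ≤ Real.exp ((t - h) * X ω + h * (x - δ) * m) := by
        rw [Real.exp_le_exp]
        nlinarith
      linarith
  rw [integral_add (by exact i1.add i2) i3, integral_add i1 i2, integral_mul_const, integral_mul_const,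
    integral_indicator_const _ hAm, ← mgf, ← mgf, ← mgf, e0, e1, e2, ← Real.exp_add,
    ← Real.exp_add, smul_eq_mul] at hle
  -- Each tail takes at most a quarter of the tilted mass, which leaves half for the window.
  have b1 : Real.exp (m * a₁ + h * (x - δ) * m) ≤ Real.exp (m * a) / 4 := by
    have : Real.exp (m * a₁ + h * (x - δ) * m) ≤ Real.exp (m * a) * Real.exp (-(m * κ)) := by
      rw [← Real.exp_add, Real.exp_le_exp]
      nlinarith
    nlinarith [Real.exp_pos (m * a)]
  have b2 : Real.exp (m * a₂ + -(h * (x + δ) * m)) ≤ Real.exp (m * a) / 4 := by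
    have : Real.exp (m * a₂ + -(h * (x + δ) * m)) ≤ Real.exp (m * a) * Real.exp (-(m * κ)) := by
      rw [← Real.exp_add, Real.exp_le_exp]
      nlinarith
    nlinarith [Real.exp_pos (m * a)]
  have b3 : Real.exp (m * a) / 2 ≤ μ.real A * Real.exp (t * (x + δ) * m) := by linarith
  have b4 : Real.exp (m * (a - t * (x + δ))) = Real.exp (m * a) / Real.exp (t * (x + δ) * m) := by
    rw [← Real.exp_sub]; congr 1; ring
  rw [b4, div_right_comm, div_le_iff₀ (Real.exp_pos _)]
  exact b3

variable [IsProbabilityMeasure μ]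

/-- Chebyshev's inequality for the number of pairwise independent variables in a set. -/
lemma measure_sum_indicator_le {S : ℕ → Ω → ℝ} (hS : ∀ i, Measurable (S i))
    (hind : Pairwise fun i j => IndepFun (S i) (S j) μ) {B : Set ℝ} (hB : MeasurableSet B)
    {p : ℝ} (hp : 0 < p) (hpS : ∀ i, p ≤ μ.real (S i ⁻¹' B)) {N : ℕ} (hN : 0 < N) :
    μ {ω | ∑ i ∈ Finset.range N, B.indicator (1 : ℝ → ℝ) (S i ω) ≤ N * p / 2} ≤
      ENNReal.ofReal (4 / (N * p)) := by
  have hBm : Measurable (B.indicator (1 : ℝ → ℝ)) := measurable_one.indicator hB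
  set Y : ℕ → Ω → ℝ := fun i ω => B.indicator (1 : ℝ → ℝ) (S i ω) with hY
  have hYm : ∀ i, Measurable (Y i) := fun i => hBm.comp (hS i)
  have hY0 : ∀ i ω, 0 ≤ Y i ω := fun i ω => Set.indicator_nonneg (fun _ _ => zero_le_one) _
  have hYb : ∀ i ω, Y i ω ≤ 1 := fun i ω => by
    by_cases h : S i ω ∈ B <;> simp [hY, h]
  have hYL : ∀ i, MemLp (Y i) 2 μ := fun i =>
    MemLp.of_bound (hYm i).aestronglyMeasurable 1 (Eventually.of_forall fun ω => by
      rw [Real.norm_eq_abs, abs_of_nonneg (hY0 i ω)]; exact hYb i ω)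
  have hYi : ∀ i, Integrable (Y i) μ := fun i => (hYL i).integrable (by norm_num)
  have hYint : ∀ i, ∫ ω, Y i ω ∂μ = μ.real (S i ⁻¹' B) := fun i => by
    have : Y i = (S i ⁻¹' B).indicator 1 := by ext ω; rfl
    rw [this, integral_indicator_one (hS i hB)]
  have hvar : ∀ i, Var[Y i; μ] ≤ μ.real (S i ⁻¹' B) := fun i => by
    refine (variance_le_expectation_sq (hYm i).aestronglyMeasurable).trans (le_of_eq ?_)
    rw [← hYint]
    refine integral_congr_ae (Eventually.of_forall fun ω => ?_)
    by_cases h : S i ω ∈ B <;> simp [hY, h]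
  set e := ∑ i ∈ Finset.range N, μ.real (S i ⁻¹' B) with he
  have hNp : 0 < N * p := by positivity
  have hle : N * p ≤ e := by
    have := Finset.card_nsmul_le_sum (Finset.range N) (fun i => μ.real (S i ⁻¹' B)) p
      fun i _ => hpS i
    simpa using this
  have hsumvar : Var[∑ i ∈ Finset.range N, Y i; μ] ≤ e := by
    rw [IndepFun.variance_sum (fun i _ => hYL i) fun i _ j _ hij => (hind hij).comp hBm hBm]
    exact Finset.sum_le_sum fun i _ => hvar i
  have hmean : ∫ ω, (∑ i ∈ Finset.range N, Y i) ω ∂μ = e := by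
    simp only [Finset.sum_apply]
    rw [integral_finsetSum _ fun i _ => hYi i]
    exact Finset.sum_congr rfl fun i _ => hYint i
  have hche := meas_ge_le_variance_div_sq (memLp_finsetSum' (Finset.range N) fun i _ => hYL i)
    (c := e / 2) (by linarith)
  rw [hmean] at hche
  refine (measure_mono fun ω hω => ?_).trans (hche.trans (ENNReal.ofReal_le_ofReal ?_))
  · simp only [Set.mem_ofPred_eq, Finset.sum_apply] at hω ⊢
    rw [abs_sub_comm]
    refine le_trans ?_ (le_abs_self _)
    linarith
  · have he0 : 0 < e := hNp.trans_le hle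
    calc _ ≤ e / (e / 2) ^ 2 := by gcongr
      _ = 4 / e := by field_simp; norm_num
      _ ≤ _ := by gcongr

/-- For large `m`, all `S i m` have the same exponential moment `e^{m (a + o(1))}` at `t`. -/
def HasUniformMGF (μ : Measure Ω) (S : ℕ → ℕ → Ω → ℝ) (t a : ℝ) : Prop :=
  ∃ r : ℕ → ℝ, Tendsto r atTop (𝓝 a) ∧ ∀ᶠ m : ℕ in atTop, ∀ i,
    t ∈ integrableExpSet (S i m) μ ∧ mgf (S i m) μ t = Real.exp (m * r m)

lemma half_exp_le_floor {x : ℝ} (hx : 0 ≤ x) : Real.exp x / 2 ≤ (⌊Real.exp x⌋₊ : ℝ) := by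
  have h1 : 1 ≤ Real.exp x := Real.one_le_exp hx
  have h2 := Nat.lt_floor_add_one (Real.exp x)
  have h3 : (1 : ℝ) ≤ (⌊Real.exp x⌋₊ : ℝ) := by
    exact_mod_cast Nat.le_floor (by simpa using h1)
  linarith

/-- Each term of `∑ e^{t S_i}` is at most the whole sum, so control of the sum gives `S_i ≤ m K /
t`. The factor `e^{(β - t) S_i}` is bounded by this, which needs `t ≤ β`. -/
lemma ae_eventually_log_sum_le {S : ℕ → ℕ → Ω → ℝ} {β q t a : ℝ} (ht : 0 < t) (htβ : t ≤ β)
    (hq : 0 < q) (h : HasUniformMGF μ S t a) {ε : ℝ} (hε : 0 < ε) :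
    ∀ᵐ ω ∂μ, ∀ᶠ m : ℕ in atTop, Real.log (1 / (⌊Real.exp (q * m)⌋₊ : ℝ) *
      ∑ i ∈ Finset.range ⌊Real.exp (q * m)⌋₊, Real.exp (β * S i m ω)) ≤
        m * (β / t * (q + a) - q + ε) := by
  obtain ⟨r, hr, h⟩ := h
  have hβ : 0 < β := ht.trans_le htβ
  -- Scaled so that `(β / t) ε' = ε / 2`; the other half of `ε` absorbs the `log 2` lost to the
  -- floor.
  set ε' := ε * t / (2 * β) with hε'
  have hε'0 : 0 < ε' := by positivity
  set K := q + a + ε' with hK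
  have hbad : ∀ᵐ ω ∂μ, ∀ᶠ m : ℕ in atTop, ω ∉ {ω | Real.exp (m * K) ≤
      ∑ i ∈ Finset.range ⌊Real.exp (q * m)⌋₊, Real.exp (t * S i m ω)} := by
    refine ae_eventually_notMem_of_le_exp (C := 1) (half_pos hε'0) ?_
    filter_upwards [h, hr.eventually (gt_mem_nhds (show a < a + ε' / 2 by linarith))]
      with m hm hrm
    have hint : Integrable (fun ω => ∑ i ∈ Finset.range ⌊Real.exp (q * m)⌋₊,
        Real.exp (t * S i m ω)) μ := integrable_finsetSum _ fun i _ => (hm i).1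
    have hmar := mul_meas_ge_le_integral_of_nonneg (Eventually.of_forall fun ω =>
      Finset.sum_nonneg fun i _ => (Real.exp_pos (t * S i m ω)).le) hint (Real.exp (m * K))
    rw [integral_finsetSum _ fun i _ => (hm i).1] at hmar
    have hs : ∑ i ∈ Finset.range ⌊Real.exp (q * m)⌋₊, ∫ ω, Real.exp (t * S i m ω) ∂μ =
        ⌊Real.exp (q * m)⌋₊ * Real.exp (m * r m) := by
      change ∑ i ∈ Finset.range _, mgf (S i m) μ t = _
      rw [Finset.sum_congr rfl fun i _ => (hm i).2]
      simp
    rw [hs] at hmar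
    rw [← ENNReal.ofReal_toReal (measure_ne_top μ _)]
    refine ENNReal.ofReal_le_ofReal ?_
    change μ.real _ ≤ _
    have hfl : (⌊Real.exp (q * m)⌋₊ : ℝ) ≤ Real.exp (q * m) := Nat.floor_le (Real.exp_pos _).le
    have h5 : (⌊Real.exp (q * m)⌋₊ : ℝ) * Real.exp (m * r m) ≤
        Real.exp (m * K) * Real.exp (-(ε' / 2 * m)) := by
      refine (mul_le_mul_of_nonneg_right hfl (Real.exp_pos _).le).trans ?_
      rw [← Real.exp_add, ← Real.exp_add, Real.exp_le_exp]
      have : (m : ℝ) * r m ≤ m * (a + ε' / 2) :=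
        mul_le_mul_of_nonneg_left hrm.le (Nat.cast_nonneg m)
      rw [hK]
      nlinarith
    rw [one_mul]
    exact le_of_mul_le_mul_left (hmar.trans h5) (Real.exp_pos _)
  have hlog : ∀ᶠ m : ℕ in atTop, Real.log 2 ≤ m * (ε / 2) := by
    have : Tendsto (fun m : ℕ => (m : ℝ) * (ε / 2)) atTop atTop :=
      tendsto_natCast_atTop_atTop.atTop_mul_const (half_pos hε)
    exact this.eventually_ge_atTop _
  filter_upwards [hbad] with ω hω
  filter_upwards [hω, hlog] with m hm hlogm
  simp only [not_le] at hm
  set N := ⌊Real.exp (q * m)⌋₊ with hN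
  have hNle : Real.exp (q * m) / 2 ≤ N := half_exp_le_floor (by positivity)
  have hN0 : 0 < (N : ℝ) := lt_of_lt_of_le (by positivity) hNle
  have hNnat : 0 < N := Nat.cast_pos.1 hN0
  have hterm : ∀ i ∈ Finset.range N, Real.exp (β * S i m ω) ≤
      Real.exp (t * S i m ω) * Real.exp ((β - t) * (m * K / t)) := by
    intro i hi
    have h1 : Real.exp (t * S i m ω) ≤ Real.exp (m * K) :=
      (Finset.single_le_sum (f := fun i => Real.exp (t * S i m ω))
        (fun i _ => (Real.exp_pos _).le) hi).trans hm.le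
    rw [Real.exp_le_exp] at h1
    rw [← Real.exp_add, Real.exp_le_exp]
    have h2 : S i m ω ≤ m * K / t := by rw [le_div_iff₀ ht]; linarith
    nlinarith [mul_le_mul_of_nonneg_left h2 (sub_nonneg.2 htβ)]
  have hsum : ∑ i ∈ Finset.range N, Real.exp (β * S i m ω) ≤ Real.exp (β / t * (m * K)) := by
    refine (Finset.sum_le_sum hterm).trans ?_
    rw [← Finset.sum_mul]
    refine (mul_le_mul_of_nonneg_right hm.le (Real.exp_pos _).le).trans (le_of_eq ?_)
    rw [← Real.exp_add]
    congr 1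
    field_simp
    ring_nf
  have hpos : 0 < ∑ i ∈ Finset.range N, Real.exp (β * S i m ω) :=
    Finset.sum_pos (fun i _ => Real.exp_pos _) (Finset.nonempty_range_iff.2 hNnat.ne')
  rw [Real.log_mul (by positivity) hpos.ne', one_div, Real.log_inv]
  have l1 : Real.log (∑ i ∈ Finset.range N, Real.exp (β * S i m ω)) ≤ β / t * (m * K) := by
    rw [← Real.log_exp (β / t * (m * K))]
    exact Real.log_le_log hpos hsum
  have l2 : q * m - Real.log 2 ≤ Real.log N := by
    rw [← Real.log_exp (q * m), ← Real.log_div (Real.exp_pos _).ne' two_ne_zero]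
    exact Real.log_le_log (by positivity) hNle
  have l3 : β / t * (m * K) = m * (β / t * (q + a)) + m * (ε / 2) := by
    rw [hK, hε']; field_simp
  nlinarith

lemma ae_eventually_le_log_sum {S : ℕ → ℕ → Ω → ℝ} (hS : ∀ i m, Measurable (S i m))
    (hind : ∀ m, Pairwise fun i j => IndepFun (S i m) (S j m) μ) {β q t x : ℝ} {Λ : ℝ → ℝ}
    (hβ : 0 < β) (ht : 0 < t) (hq : 0 < q) (hΛ : ∀ᶠ u in 𝓝 t, HasUniformMGF μ S u (Λ u))
    (hx : HasDerivAt Λ x t) (hI : t * x - Λ t < q) {ε : ℝ} (hε : 0 < ε) :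
    ∀ᵐ ω ∂μ, ∀ᶠ m : ℕ in atTop, m * (β * x - (t * x - Λ t) - ε) ≤
      Real.log (1 / (⌊Real.exp (q * m)⌋₊ : ℝ) *
        ∑ i ∈ Finset.range ⌊Real.exp (q * m)⌋₊, Real.exp (β * S i m ω)) := by
  set I := t * x - Λ t with hIdef
  -- The four units of `ρ` pay for the limit error in `r`, for `t δ`, for `β δ` and for the constant
  -- `log 4`.
  obtain ⟨ρ, hρ0, hρε, hρq⟩ : ∃ ρ > 0, 4 * ρ ≤ ε ∧ I + 2 * ρ < q := by
    refine ⟨min (ε / 4) ((q - I) / 4), lt_min (by linarith) (by linarith), ?_, ?_⟩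
    · have := min_le_left (ε / 4) ((q - I) / 4); linarith
    · have := min_le_right (ε / 4) ((q - I) / 4); linarith
  set δ := ρ / (t + β) with hδ
  have hδ0 : 0 < δ := by positivity
  have htδ : t * δ ≤ ρ := by
    rw [hδ, ← mul_div_assoc, div_le_iff₀ (by positivity)]; nlinarith
  have hβδ : β * δ ≤ ρ := by
    rw [hδ, ← mul_div_assoc, div_le_iff₀ (by positivity)]; nlinarith
  -- Differentiability at `t` makes the error in the linear approximation at `t ± h` at most `h δ /
  -- 2`, so both tails beyond `x ± δ` are exponentially small under the tilt.
  obtain ⟨h, hh0, hm1, hm2, hd1, hd2⟩ : ∃ h > 0, HasUniformMGF μ S (t - h) (Λ (t - h)) ∧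
      HasUniformMGF μ S (t + h) (Λ (t + h)) ∧ Λ (t - h) + h * (x - δ) ≤ Λ t - h * δ / 2 ∧
      Λ (t + h) - h * (x + δ) ≤ Λ t - h * δ / 2 := by
    have hlo := (hasDerivAt_iff_isLittleO.1 hx).bound (half_pos hδ0)
    obtain ⟨R, hR0, hR⟩ := Metric.eventually_nhds_iff.1 (hΛ.and hlo)
    have k1 := hR (y := t - R / 2) (by rw [Real.dist_eq, abs_lt]; constructor <;> linarith)
    have k2 := hR (y := t + R / 2) (by rw [Real.dist_eq, abs_lt]; constructor <;> linarith)
    refine ⟨R / 2, by linarith, k1.1, k2.1, ?_, ?_⟩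
    · have := (le_abs_self _).trans k1.2
      rw [smul_eq_mul, sub_sub_cancel_left, norm_neg, Real.norm_of_nonneg (by linarith)] at this
      nlinarith
    · have := (le_abs_self _).trans k2.2
      rw [smul_eq_mul, add_sub_cancel_left, Real.norm_of_nonneg (by linarith)] at this
      nlinarith
  obtain ⟨r, hr, hmr⟩ := hΛ.self_of_nhds
  obtain ⟨r₁, hr₁, hmr₁⟩ := hm1
  obtain ⟨r₂, hr₂, hmr₂⟩ := hm2
  set κ := h * δ / 4 with hκ
  have hκ0 : 0 < κ := by positivity
  set p : ℕ → ℝ := fun m => Real.exp (-(m * (I + 2 * ρ))) / 2 with hp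
  have hprob : ∀ᶠ m : ℕ in atTop, ∀ i, p m ≤ μ.real (S i m ⁻¹' Set.Ici ((x - δ) * m)) := by
    have t1 : ∀ᶠ m in atTop, r₁ m - r m < Λ (t - h) - Λ t + κ :=
      (hr₁.sub hr).eventually (gt_mem_nhds (by linarith))
    have t2 : ∀ᶠ m in atTop, r₂ m - r m < Λ (t + h) - Λ t + κ :=
      (hr₂.sub hr).eventually (gt_mem_nhds (by linarith))
    have t3 : ∀ᶠ m in atTop, Λ t - ρ < r m := hr.eventually (lt_mem_nhds (by linarith))
    have t4 : ∀ᶠ m : ℕ in atTop, Real.log 4 ≤ m * κ :=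
      (tendsto_natCast_atTop_atTop.atTop_mul_const hκ0).eventually_ge_atTop _
    filter_upwards [hmr, hmr₁, hmr₂, t1, t2, t3, t4] with m q0 q1 q2 s1 s2 s3 s4 i
    have hκm : 4 * Real.exp (-(m * κ)) ≤ 1 := by
      rw [← Real.exp_log (show (0 : ℝ) < 4 by norm_num), ← Real.exp_add, ← Real.exp_zero,
        Real.exp_le_exp]
      linarith
    refine le_trans ?_ (le_measureReal_of_mgf_eq (hS i m) (x := x) (δ := δ) ht.le hh0.le
      (Nat.cast_nonneg m) hκm (q0 i).1 (q1 i).1 (q2 i).1 (q0 i).2 (q1 i).2 (q2 i).2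
      (by linarith) (by linarith))
    simp only [hp]
    gcongr
    rw [← mul_neg]
    refine mul_le_mul_of_nonneg_left ?_ (Nat.cast_nonneg m)
    nlinarith
  have hbad : ∀ᵐ ω ∂μ, ∀ᶠ m : ℕ in atTop, ω ∉ {ω | ∑ i ∈ Finset.range ⌊Real.exp (q * m)⌋₊,
      (Set.Ici ((x - δ) * m)).indicator (1 : ℝ → ℝ) (S i m ω) ≤
        (⌊Real.exp (q * m)⌋₊ : ℝ) * p m / 2} := by
    -- Chebyshev gives `4 / (N p)`; the floor and the factor in `p` cost `2` each.
    refine ae_eventually_notMem_of_le_exp (C := 16) (c := q - (I + 2 * ρ)) (by linarith) ?_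
    filter_upwards [hprob] with m hm
    have hNle : Real.exp (q * m) / 2 ≤ ⌊Real.exp (q * m)⌋₊ := half_exp_le_floor (by positivity)
    have hN0 : 0 < (⌊Real.exp (q * m)⌋₊ : ℝ) := lt_of_lt_of_le (by positivity) hNle
    have hp0 : 0 < p m := by positivity
    refine (measure_sum_indicator_le (fun i => hS i m) (hind m) measurableSet_Ici hp0 hm
      (Nat.cast_pos.1 hN0)).trans (ENNReal.ofReal_le_ofReal ?_)
    rw [div_le_iff₀ (by positivity)]
    have h6 : Real.exp (-((q - (I + 2 * ρ)) * m)) * (Real.exp (q * m) / 2 * p m) = 1 / 4 := by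
      have : Real.exp (-((q - (I + 2 * ρ)) * m)) * (Real.exp (q * m) / 2 * p m) =
          Real.exp (-((q - (I + 2 * ρ)) * m)) * Real.exp (q * m) *
            Real.exp (-(m * (I + 2 * ρ))) / 4 := by simp only [hp]; ring
      rw [this, ← Real.exp_add, ← Real.exp_add]
      congr 1
      rw [← Real.exp_zero]
      congr 1
      ring
    have h7 : Real.exp (-((q - (I + 2 * ρ)) * m)) * (Real.exp (q * m) / 2 * p m) ≤
        Real.exp (-((q - (I + 2 * ρ)) * m)) * (⌊Real.exp (q * m)⌋₊ * p m) := by gcongr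
    linarith
  have hlog : ∀ᶠ m : ℕ in atTop, Real.log 4 ≤ m * ρ :=
    (tendsto_natCast_atTop_atTop.atTop_mul_const hρ0).eventually_ge_atTop _
  filter_upwards [hbad] with ω hω
  filter_upwards [hω, hlog] with m hm hlogm
  simp only [not_le] at hm
  set N := ⌊Real.exp (q * m)⌋₊ with hN
  have hNle : Real.exp (q * m) / 2 ≤ N := half_exp_le_floor (by positivity)
  have hN0 : 0 < (N : ℝ) := lt_of_lt_of_le (by positivity) hNle
  have hterm : ∀ i ∈ Finset.range N, (Set.Ici ((x - δ) * m)).indicator (1 : ℝ → ℝ) (S i m ω) *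
      Real.exp (β * ((x - δ) * m)) ≤ Real.exp (β * S i m ω) := by
    intro i _
    simp only [Set.indicator_apply, Set.mem_Ici]
    split_ifs with hc
    · simp only [Pi.one_apply, one_mul, Real.exp_le_exp]
      exact mul_le_mul_of_nonneg_left hc hβ.le
    · simpa using (Real.exp_pos _).le
  have hsum := Finset.sum_le_sum hterm
  rw [← Finset.sum_mul] at hsum
  have hge : Real.exp (m * (β * x - β * δ - (I + 2 * ρ))) / 4 ≤
      1 / (N : ℝ) * ∑ i ∈ Finset.range N, Real.exp (β * S i m ω) := by
    have h8 : N * p m / 2 * Real.exp (β * ((x - δ) * m)) ≤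
        ∑ i ∈ Finset.range N, Real.exp (β * S i m ω) :=
      (mul_le_mul_of_nonneg_right hm.le (Real.exp_pos _).le).trans hsum
    rw [one_div, inv_mul_eq_div, le_div_iff₀ hN0]
    refine le_trans (le_of_eq ?_) h8
    have h9 : Real.exp (m * (β * x - β * δ - (I + 2 * ρ))) =
        Real.exp (-(m * (I + 2 * ρ))) * Real.exp (β * ((x - δ) * m)) := by
      rw [← Real.exp_add]; congr 1; ring
    rw [h9]
    simp only [hp]
    ring
  have hfin := Real.log_le_log (by positivity) hge
  rw [Real.log_div (Real.exp_pos _).ne' (by norm_num), Real.log_exp] at hfin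
  refine le_trans ?_ hfin
  have hm0 : (0 : ℝ) ≤ m := Nat.cast_nonneg m
  nlinarith

end LargeDeviations

/-! ### First-order conditions for the free energy. -/

/-- The derivative of `(β / t) (q + Λ(t)) - q` is `(β / t²) (t Λ'(t) - Λ(t) - q)`. It is nonpositive
at a minimiser other than the left end, which is the constraint. It vanishes at an interior one, and
at `t = β` the value identity holds without that. -/
lemma exists_minimum_div_add {Λ : ℝ → ℝ} {β δ q : ℝ} (hδ : 0 < δ) (hδβ : δ ≤ β)
    (hΛ : ∀ t ∈ Set.Icc δ β, DifferentiableAt ℝ Λ t)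
    (hlt : ∃ u ∈ Set.Icc δ β, β / u * (q + Λ u) - q < β / δ * (q + Λ δ) - q) :
    ∃ t ∈ Set.Ioc δ β, (∀ u ∈ Set.Icc δ β, β / t * (q + Λ t) - q ≤ β / u * (q + Λ u) - q) ∧
      t * deriv Λ t - Λ t ≤ q ∧
      β * deriv Λ t - (t * deriv Λ t - Λ t) = β / t * (q + Λ t) - q := by
  set g : ℝ → ℝ := fun t => β / t * (q + Λ t) - q with hg
  have hβ : 0 < β := hδ.trans_le hδβ
  have hderiv : ∀ t ∈ Set.Icc δ β,
      HasDerivAt g (β / t ^ 2 * (t * deriv Λ t - Λ t - q)) t := by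
    intro t ht
    have ht0 : t ≠ 0 := (hδ.trans_le ht.1).ne'
    have h1 := ((((hasDerivAt_inv ht0).const_mul β).mul
      ((hΛ t ht).hasDerivAt.const_add q)).sub_const q)
    refine (h1.congr_deriv ?_).congr_of_eventuallyEq (Eventually.of_forall fun u => ?_)
    · field_simp
      ring
    · simp [hg, div_eq_mul_inv]
  obtain ⟨t, ht, hmin⟩ := isCompact_Icc.exists_isMinOn (Set.nonempty_Icc.2 hδβ)
    (fun u hu => (hderiv u hu).continuousAt.continuousWithinAt)
  have hmin' : ∀ u ∈ Set.Icc δ β, g t ≤ g u := fun u hu => hmin hu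
  have htδ : δ < t := by
    refine lt_of_le_of_ne ht.1 ?_
    rintro rfl
    obtain ⟨u, hu, hu'⟩ := hlt
    exact absurd (hmin' u hu) (not_le.2 hu')
  have ht0 : 0 < t := hδ.trans htδ
  have hle : β / t ^ 2 * (t * deriv Λ t - Λ t - q) ≤ 0 := by
    have h1 := (hasDerivAt_iff_tendsto_slope.1 (hderiv t ht)).mono_left
      (nhdsWithin_mono t (s := Set.Iio t) fun u hu => ne_of_lt hu)
    refine le_of_tendsto h1 ?_
    filter_upwards [Ioo_mem_nhdsLT htδ] with u hu
    rw [slope_def_field]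
    refine div_nonpos_of_nonneg_of_nonpos ?_ (by linarith [hu.2])
    linarith [hmin' u ⟨hu.1.le, hu.2.le.trans ht.2⟩]
  have hpos : 0 < β / t ^ 2 := by positivity
  have hI : t * deriv Λ t - Λ t - q ≤ 0 := by
    by_contra hcon
    exact absurd hle (not_le.2 (mul_pos hpos (not_le.1 hcon)))
  refine ⟨t, ⟨htδ, ht.2⟩, hmin', by linarith, ?_⟩
  rcases eq_or_lt_of_le ht.2 with h | h
  · rw [h, div_self hβ.ne']
    ring
  · have hloc : IsLocalMin g t := by
      filter_upwards [Icc_mem_nhds htδ h] with u hu using hmin' u hu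
    have h2 := hloc.hasDerivAt_eq_zero (hderiv t ht)
    have h3 : t * deriv Λ t - Λ t - q = 0 := (mul_eq_zero.1 h2).resolve_left hpos.ne'
    have h4 : Λ t = t * deriv Λ t - q := by linarith
    rw [h4]
    field_simp
    ring

/-! ### Duality between the free energy and the rate function. -/

section FreeEnergy

variable {Ω : Type*} [MeasurableSpace Ω] {μ : Measure Ω} {X : Ω → ℝ} {χ : ℝ → ℝ}

/-- The values `(β / t) (q + χ (log E e^{tX})) - q`, for `0 < t ≤ β` at which the exponential moment
is finite. -/
def freeEnergySet (μ : Measure Ω) (X : Ω → ℝ) (χ : ℝ → ℝ) (β q : ℝ) : Set ℝ :=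
  (fun t => β / t * (q + χ (cgf X μ t)) - q) '' {t | 0 < t ∧ t ≤ β ∧ t ∈ integrableExpSet X μ}

/-- Test both suprema at matching points, `t` for the Cramér transform and `φ(t)` for `ψ`; the terms
`y φ(t)` cancel. -/
lemma mul_sub_le_rateFunction {t : ℝ} (ht : 0 ≤ t) (hti : t ∈ integrableExpSet X μ)
    (hc : 0 ≤ cgf X μ t) (x : ℝ) :
    ((t * x - χ (cgf X μ t) : ℝ) : EReal) ≤
      rateFunction (legendreTransform χ) (cramerTransform μ X) x := by
  refine le_iInf₂ fun y hy => ?_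
  have hy0 : 0 < y := hy
  have h1 : ((y * cgf X μ t - χ (cgf X μ t) : ℝ) : EReal) ≤ legendreTransform χ y :=
    le_iSup₂ (f := fun (s : ℝ) (_ : s ∈ Set.Ici (0 : ℝ)) => ((y * s - χ s : ℝ) : EReal)) _ hc
  have h2 : ((x / y * t - cgf X μ t : ℝ) : EReal) ≤ cramerTransform μ X (x / y) :=
    le_iSup₂ (f := fun (s : ℝ) (_ : s ∈ {t : ℝ | 0 ≤ t ∧ t ∈ integrableExpSet X μ}) =>
      ((x / y * s - cgf X μ s : ℝ) : EReal)) t ⟨ht, hti⟩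
  have h3 : ((y * (x / y * t - cgf X μ t) : ℝ) : EReal) ≤
      (y : EReal) * cramerTransform μ X (x / y) := by
    rw [EReal.coe_mul]
    exact mul_le_mul_of_nonneg_left h2 (EReal.coe_nonneg.2 hy0.le)
  refine le_trans (le_of_eq ?_) (add_le_add h1 h3)
  rw [← EReal.coe_add]
  congr 1
  field_simp
  ring

lemma bddBelow_freeEnergySet (hχ : ∀ t, 0 ≤ t → t ≤ χ t) {β q : ℝ} (hq : 0 < q)
    (hc : ∀ t, 0 ≤ t → t ∈ integrableExpSet X μ → 0 ≤ cgf X μ t) :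
    BddBelow (freeEnergySet μ X χ β q) := by
  refine ⟨0, ?_⟩
  rintro _ ⟨t, ⟨ht, htβ, hti⟩, rfl⟩
  have h1 := hc t ht.le hti
  have h2 := h1.trans (hχ _ h1)
  have h3 : 1 ≤ β / t := (one_le_div ht).2 htβ
  simp only
  nlinarith

/-- Weak duality: from `t x ≤ ν(x) + Λ(t)`, `ν(x) ≤ q` and `β / t ≥ 1`, one gets `β x - ν(x) ≤ (β /
t) (q + Λ(t)) - q`. -/
lemma neg_sInf_le_constrainedInf {β q : ℝ} (hne : (freeEnergySet μ X χ β q).Nonempty)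
    (hc : ∀ t, 0 ≤ t → t ∈ integrableExpSet X μ → 0 ≤ cgf X μ t) :
    ((-sInf (freeEnergySet μ X χ β q) : ℝ) : EReal) ≤
      constrainedInf (rateFunction (legendreTransform χ) (cramerTransform μ X)) β q := by
  refine le_iInf₂ fun x hx => ?_
  have hxq : rateFunction (legendreTransform χ) (cramerTransform μ X) x ≤ (q : EReal) := hx
  have hlow : ∀ t, 0 ≤ t → t ∈ integrableExpSet X μ → ((t * x - χ (cgf X μ t) : ℝ) : EReal) ≤
      rateFunction (legendreTransform χ) (cramerTransform μ X) x :=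
    fun t ht hti => mul_sub_le_rateFunction ht hti (hc t ht hti) x
  generalize rateFunction (legendreTransform χ) (cramerTransform μ X) x = r at hxq hlow ⊢
  have hbot : r ≠ ⊥ := by
    obtain ⟨_, t, ⟨ht, -, hti⟩, -⟩ := hne
    exact ne_bot_of_le_ne_bot (EReal.coe_ne_bot _) (hlow t ht.le hti)
  have htop : r ≠ ⊤ := ne_top_of_le_ne_top (EReal.coe_ne_top _) hxq
  lift r to ℝ using ⟨htop, hbot⟩
  rw [← EReal.coe_sub, EReal.coe_le_coe_iff]
  have h1 : β * x - r ≤ sInf (freeEnergySet μ X χ β q) := by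
    refine le_csInf hne ?_
    rintro _ ⟨t, ⟨ht, htβ, hti⟩, rfl⟩
    have h2 := EReal.coe_le_coe_iff.1 (hlow t ht.le hti)
    have h3 := EReal.coe_le_coe_iff.1 hxq
    have h4 : 1 ≤ β / t := (one_le_div ht).2 htβ
    have h5 : β * x = β / t * (t * x) := by field_simp
    simp only
    rw [h5]
    have h6 : β / t * (t * x) ≤ β / t * (r + χ (cgf X μ t)) :=
      mul_le_mul_of_nonneg_left (by linarith) (by linarith)
    nlinarith
  linarith

variable [IsProbabilityMeasure μ]

/-- Take `y = χ'(Φ(t))` in the infimum, so that `x / y = Φ'(t)` by the chain rule. The supporting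
lines of `χ` at `Φ(t)` and of `Φ` at `t` bound the two transforms; since `Φ` lies below `φ`, its
line also supports `φ` from below. -/
lemma rateFunction_le_of_truncation (hX : AEMeasurable X μ) (hχ_conv : ConvexOn ℝ (Set.Ici 0) χ)
    (hχ0 : χ 0 = 0) (hχ : ∀ t, 0 ≤ t → t ≤ χ t) {M t : ℝ} (ht : 0 < t)
    (hpos : 0 < cgf (fun ω => min (X ω) M) μ t)
    (hd : DifferentiableAt ℝ χ (cgf (fun ω => min (X ω) M) μ t)) :
    rateFunction (legendreTransform χ) (cramerTransform μ X)
        (deriv (fun u => χ (cgf (fun ω => min (X ω) M) μ u)) t) ≤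
      ((t * deriv (fun u => χ (cgf (fun ω => min (X ω) M) μ u)) t -
        χ (cgf (fun ω => min (X ω) M) μ t) : ℝ) : EReal) := by
  set Φ := cgf (fun ω => min (X ω) M) μ with hΦ
  have hΦd := differentiableAt_cgf_min hX M ht
  have hderiv : deriv (fun u => χ (Φ u)) t = deriv χ (Φ t) * deriv Φ t :=
    (hd.hasDerivAt.comp t hΦd.hasDerivAt).deriv
  rw [hderiv]
  set y := deriv χ (Φ t) with hy
  set z := deriv Φ t with hz
  have hy0 : 0 < y := by
    have h1 := hχ_conv.add_mul_sub_le (y := 0) (Set.mem_Ici.2 hpos.le) (Set.mem_Ici.2 le_rfl)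
      hd.hasDerivAt
    have h2 := hχ _ hpos.le
    rw [hχ0] at h1
    by_contra hcon
    nlinarith
  have hψ : legendreTransform χ y ≤ ((y * Φ t - χ (Φ t) : ℝ) : EReal) := by
    refine iSup₂_le fun s hs => EReal.coe_le_coe_iff.2 ?_
    have := hχ_conv.add_mul_sub_le (Set.mem_Ici.2 hpos.le) hs hd.hasDerivAt
    linarith
  have hφ : cramerTransform μ X (y * z / y) ≤ ((z * t - Φ t : ℝ) : EReal) := by
    rw [mul_div_cancel_left₀ _ hy0.ne']
    refine iSup₂_le fun s hs => EReal.coe_le_coe_iff.2 ?_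
    have h1 := convexOn_cgf.add_mul_sub_le (mem_integrableExpSet_min hX M ht.le)
      (mem_integrableExpSet_min hX M hs.1) hΦd.hasDerivAt
    have h2 := cgf_min_le hX M hs.1 hs.2
    rw [← hΦ] at h1 h2
    linarith
  refine (iInf₂_le y (Set.mem_Ioi.2 hy0)).trans ?_
  have h3 : (y : EReal) * cramerTransform μ X (y * z / y) ≤ ((y * (z * t - Φ t) : ℝ) : EReal) := by
    rw [EReal.coe_mul]
    exact mul_le_mul_of_nonneg_left hφ (EReal.coe_nonneg.2 hy0.le)
  refine (add_le_add hψ h3).trans (le_of_eq ?_)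
  rw [← EReal.coe_add]
  congr 1
  ring

lemma cgf_min_pos_of_le (hX : AEMeasurable X μ) {M s t : ℝ} (hs : 0 < s) (hst : s ≤ t)
    (h : 0 < cgf (fun ω => min (X ω) M) μ s) : 0 < cgf (fun ω => min (X ω) M) μ t := by
  have ht : 0 < t := hs.trans_le hst
  have h1 := (convexOn_cgf (X := fun ω => min (X ω) M)).2
    (mem_integrableExpSet_min (μ := μ) hX M le_rfl) (mem_integrableExpSet_min hX M ht.le)
    (sub_nonneg.2 ((div_le_one ht).2 hst)) (div_pos hs ht).le (sub_add_cancel 1 (s / t))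
  simp only [smul_eq_mul, mul_zero, zero_add, cgf_zero, div_mul_cancel₀ s ht.ne'] at h1
  exact pos_of_mul_pos_right (h.trans_le h1) (div_pos hs ht).le

/-- A nondegenerate variable, truncated at a high level, has a point of the exponential tilt which
satisfies the constraint strictly and is nearly optimal. -/
lemma exists_truncation_near_sInf (hX : AEMeasurable X μ)
    (hχ_mono : ∀ s t, 0 ≤ s → s ≤ t → χ s ≤ χ t) (hχ : ∀ t, 0 ≤ t → t ≤ χ t)
    (hχ_diff : ∀ t, 0 < t → DifferentiableAt ℝ χ t)
    (hc : ∀ t, 0 < t → t ∈ integrableExpSet X μ → 0 < cgf X μ t)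
    (hXe : ∃ t, 0 < t ∧ t ∈ integrableExpSet X μ) {β q ε : ℝ} (hβ : 0 < β) (hq : 0 < q)
    (hε : 0 < ε) :
    ∃ M t : ℝ, 0 < t ∧ 0 < cgf (fun ω => min (X ω) M) μ t ∧
      t * deriv (fun u => χ (cgf (fun ω => min (X ω) M) μ u)) t -
        χ (cgf (fun ω => min (X ω) M) μ t) < q ∧
      sInf (freeEnergySet μ X χ β q) - ε ≤
        β * deriv (fun u => χ (cgf (fun ω => min (X ω) M) μ u)) t -
          (t * deriv (fun u => χ (cgf (fun ω => min (X ω) M) μ u)) t -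
            χ (cgf (fun ω => min (X ω) M) μ t)) := by
  set G := sInf (freeEnergySet μ X χ β q) with hG
  have hbdd : BddBelow (freeEnergySet μ X χ β q) := by
    refine bddBelow_freeEnergySet hχ hq fun t ht hti => ?_
    rcases ht.eq_or_lt with rfl | h
    · rw [cgf_zero]
    · exact (hc t h hti).le
  obtain ⟨t₀, ht₀, ht₀β, ht₀i⟩ : ∃ t, 0 < t ∧ t ≤ β ∧ t ∈ integrableExpSet X μ := by
    obtain ⟨t, ht, hti⟩ := hXe
    exact ⟨min t β, lt_min ht hβ, min_le_right _ _,
      mem_integrableExpSet_of_le (lt_min ht hβ).le (min_le_left _ _) hti⟩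
  have hΛ0 : ∀ t, 0 < t → t ∈ integrableExpSet X μ → 0 ≤ χ (cgf X μ t) := fun t ht hti =>
    (hc t ht hti).le.trans (hχ _ (hc t ht hti).le)
  set c₀ := β / t₀ * (q + χ (cgf X μ t₀)) - q with hc₀
  have hc₀0 : 0 ≤ c₀ := by
    have h1 := hΛ0 t₀ ht₀ ht₀i
    have h3 : 1 ≤ β / t₀ := (one_le_div ht₀).2 ht₀β
    nlinarith
  -- `δ` is so small that for every truncation level and every `q' ≥ q / 2` the objective at `δ`
  -- exceeds that at `t₀`, so the minimiser is not the left end.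
  obtain ⟨δ, hδ0, hδt, hδc⟩ : ∃ δ, 0 < δ ∧ δ < t₀ ∧ c₀ < (β / δ - 1) * (q / 2) := by
    have hB : 0 < β * q / (2 * (2 * c₀ + q)) := by positivity
    refine ⟨min (t₀ / 2) (β * q / (2 * (2 * c₀ + q))), lt_min (half_pos ht₀) hB,
      (min_le_left _ _).trans_lt (half_lt_self ht₀), ?_⟩
    have h1 : β / (β * q / (2 * (2 * c₀ + q))) ≤
        β / min (t₀ / 2) (β * q / (2 * (2 * c₀ + q))) :=
      div_le_div_of_nonneg_left hβ.le (lt_min (half_pos ht₀) hB) (min_le_right _ _)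
    have h2 : β / (β * q / (2 * (2 * c₀ + q))) * q = 2 * (2 * c₀ + q) := by field_simp
    nlinarith
  have hδβ : δ ≤ β := hδt.le.trans ht₀β
  -- The minimiser only satisfies its constraint weakly; working with `q' < q` makes it strict at a
  -- cost of `ε / 2`.
  obtain ⟨q', hq'q, hq'2, hq'ε⟩ : ∃ q', q' < q ∧ q / 2 ≤ q' ∧ β / δ * (q - q') ≤ ε / 2 := by
    have hBd : 0 < ε * δ / (2 * β) := by positivity
    refine ⟨q - min (q / 2) (ε * δ / (2 * β)), ?_, ?_, ?_⟩
    · linarith [lt_min (half_pos hq) hBd]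
    · linarith [min_le_left (q / 2) (ε * δ / (2 * β))]
    · rw [sub_sub_cancel]
      refine (mul_le_mul_of_nonneg_left (min_le_right _ _) (by positivity)).trans (le_of_eq ?_)
      field_simp
  have hδi : δ ∈ integrableExpSet X μ := mem_integrableExpSet_of_le hδ0.le hδt.le ht₀i
  -- From this level on the truncated `Φ` is positive on `[δ, β]`, where `χ` is known to be
  -- differentiable.
  obtain ⟨M₀, hM₀⟩ := eventually_atTop.1 ((tendsto_cgf_min hX hδ0.le hδi).eventually
    (lt_mem_nhds (hc δ hδ0 hδi)))
  set Φ : ℕ → ℝ → ℝ := fun n => cgf (fun ω => min (X ω) ((n + M₀ : ℕ) : ℝ)) μ with hΦ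
  have hΦpos : ∀ n, ∀ t ∈ Set.Icc δ β, 0 < Φ n t := fun n t ht =>
    cgf_min_pos_of_le hX hδ0 ht.1 (hM₀ (n + M₀) (by omega))
  have hΛd : ∀ n, ∀ t ∈ Set.Icc δ β, DifferentiableAt ℝ (fun u => χ (Φ n u)) t := fun n t ht =>
    (hχ_diff _ (hΦpos n t ht)).comp t (differentiableAt_cgf_min hX _ (hδ0.trans_le ht.1))
  set g : ℕ → ℝ → ℝ := fun n t => β / t * (q' + χ (Φ n t)) - q' with hg
  have hgc : ∀ n, ContinuousOn (g n) (Set.Icc δ β) := fun n => by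
    refine ContinuousOn.sub (ContinuousOn.mul (continuousOn_const.div continuousOn_id
      fun t ht => (hδ0.trans_le ht.1).ne') (continuousOn_const.add fun t ht =>
        (hΛd n t ht).continuousAt.continuousWithinAt)) continuousOn_const
  have hgmono : ∀ n, ∀ t ∈ Set.Icc δ β, g n t ≤ g (n + 1) t := fun n t ht => by
    have ht0 : 0 < t := hδ0.trans_le ht.1
    have h1 : χ (Φ n t) ≤ χ (Φ (n + 1) t) := hχ_mono _ _ (hΦpos n t ht).le
      (cgf_min_mono hX (by push_cast; linarith) ht0.le)
    simp only [hg]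
    gcongr
  by_contra hcon
  push Not at hcon
  have hmin : ∀ n, ∃ t ∈ Set.Icc δ β, g n t ≤ G - ε := by
    intro n
    obtain ⟨t, ht, -, hI, hval⟩ := exists_minimum_div_add (q := q') hδ0 hδβ (hΛd n) (by
      refine ⟨t₀, ⟨hδt.le, ht₀β⟩, ?_⟩
      have h1 : χ (Φ n t₀) ≤ χ (cgf X μ t₀) := hχ_mono _ _ (hΦpos n t₀ ⟨hδt.le, ht₀β⟩).le
        (cgf_min_le hX _ ht₀.le ht₀i)
      have h2 : 0 ≤ χ (Φ n δ) := (hΦpos n δ ⟨le_rfl, hδβ⟩).le.trans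
        (hχ _ (hΦpos n δ ⟨le_rfl, hδβ⟩).le)
      have h3 : 1 ≤ β / t₀ := (one_le_div ht₀).2 ht₀β
      have h4 : 1 ≤ β / δ := (one_le_div hδ0).2 hδβ
      have h5 : β / t₀ * (q' + χ (Φ n t₀)) - q' ≤ c₀ := by
        have : β / t₀ * (q' + χ (Φ n t₀)) ≤ β / t₀ * (q' + χ (cgf X μ t₀)) := by gcongr
        rw [hc₀]
        nlinarith
      have h6 : (β / δ - 1) * (q / 2) ≤ β / δ * (q' + χ (Φ n δ)) - q' := by
        have : (β / δ - 1) * (q / 2) ≤ (β / δ - 1) * q' :=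
          mul_le_mul_of_nonneg_left hq'2 (by linarith)
        nlinarith
      linarith)
    have hti : t ∈ Set.Icc δ β := ⟨ht.1.le, ht.2⟩
    refine ⟨t, hti, ?_⟩
    have := hcon _ t (hδ0.trans ht.1) (hΦpos n t hti) (hI.trans_lt hq'q)
    exact (hval.symm.trans_lt this).le
  -- If the claim fails, these sublevel sets are nonempty, compact and decreasing, since the
  -- objective grows with the truncation level. At a common point the untruncated objective for `q'`
  -- is at most `G - ε`, while the one for `q` is at least `G`; they differ by too little.
  set K : ℕ → Set ℝ := fun n => {t | t ∈ Set.Icc δ β ∧ g n t ≤ G - ε} with hK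
  have hKclosed : ∀ n, IsClosed (K n) := fun n =>
    (hgc n).preimage_isClosed_of_isClosed isClosed_Icc isClosed_Iic
  obtain ⟨t, ht⟩ := IsCompact.nonempty_iInter_of_sequence_nonempty_isCompact_isClosed K
    (fun n t ht => ⟨ht.1, (hgmono n t ht.1).trans ht.2⟩) (fun n => by
      obtain ⟨t, ht, h⟩ := hmin n
      exact ⟨t, ht, h⟩)
    (isCompact_Icc.of_isClosed_subset (hKclosed 0) fun t ht => ht.1) hKclosed
  rw [Set.mem_iInter] at ht
  have htI : t ∈ Set.Icc δ β := (ht 0).1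
  have ht0 : 0 < t := hδ0.trans_le htI.1
  have hti : t ∈ integrableExpSet X μ := by
    refine mem_integrableExpSet_of_cgf_min_le hX ht0.le (C := t / β * (G - ε + q') - q')
      fun n => ?_
    refine (cgf_min_mono hX (by push_cast; linarith [(Nat.cast_nonneg M₀ : (0 : ℝ) ≤ M₀)])
      ht0.le : _ ≤ Φ n t).trans ?_
    refine (hχ _ (hΦpos n t htI).le).trans ?_
    have h1 : β / t * (q' + χ (Φ n t)) ≤ G - ε + q' := by
      have := (ht n).2
      simp only [hg] at this
      linarith
    have h2 : t / β * (β / t * (q' + χ (Φ n t))) = q' + χ (Φ n t) := by field_simp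
    have h3 := mul_le_mul_of_nonneg_left h1 (show 0 ≤ t / β by positivity)
    linarith
  have hlim : Tendsto (fun n => g n t) atTop (𝓝 (β / t * (q' + χ (cgf X μ t)) - q')) := by
    have h1 : Tendsto (fun n => Φ n t) atTop (𝓝 (cgf X μ t)) :=
      (tendsto_cgf_min hX ht0.le hti).comp (tendsto_add_atTop_nat M₀)
    have h2 := (hχ_diff _ (hc t ht0 hti)).continuousAt.tendsto.comp h1
    exact ((h2.const_add q').const_mul (β / t)).sub_const q'
  have hle : β / t * (q' + χ (cgf X μ t)) - q' ≤ G - ε := le_of_tendsto' hlim fun n => (ht n).2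
  have hGle : G ≤ β / t * (q + χ (cgf X μ t)) - q :=
    csInf_le hbdd ⟨t, ⟨ht0, htI.2, hti⟩, rfl⟩
  have hdiff : β / t * (q - q') ≤ ε / 2 := by
    refine le_trans ?_ hq'ε
    exact mul_le_mul_of_nonneg_right (div_le_div_of_nonneg_left hβ.le hδ0 htI.1) (by linarith)
  nlinarith

end FreeEnergy

/-! ### Assembly of the almost sure limit. -/

/-- The exceptional null set depends on `ε`, so only the countably many values `1 / (k + 1)` are
used. -/
lemma tendsto_div_of_ae_eventually_bounds {Ω : Type*} [MeasurableSpace Ω] {μ : Measure Ω}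
    {f : ℕ → Ω → ℝ} {G : ℝ}
    (hu : ∀ ε > 0, ∀ᵐ ω ∂μ, ∀ᶠ m : ℕ in atTop, f m ω ≤ m * (G + ε))
    (hl : ∀ ε > 0, ∀ᵐ ω ∂μ, ∀ᶠ m : ℕ in atTop, m * (G - ε) ≤ f m ω) :
    ∀ᵐ ω ∂μ, Tendsto (fun m : ℕ => f m ω / m) atTop (𝓝 G) := by
  have h1 := ae_all_iff.2 fun k : ℕ => hu (1 / ((k : ℝ) + 1)) Nat.one_div_pos_of_nat
  have h2 := ae_all_iff.2 fun k : ℕ => hl (1 / ((k : ℝ) + 1)) Nat.one_div_pos_of_nat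
  filter_upwards [h1, h2] with ω hω1 hω2
  refine Metric.tendsto_nhds.2 fun ε hε => ?_
  obtain ⟨k, hk⟩ := exists_nat_one_div_lt hε
  filter_upwards [hω1 k, hω2 k, eventually_gt_atTop 0] with m hm1 hm2 hm0
  have hm : (0 : ℝ) < m := Nat.cast_pos.2 hm0
  rw [Real.dist_eq, abs_lt]
  have e1 : f m ω / m ≤ G + 1 / ((k : ℝ) + 1) := by rw [div_le_iff₀ hm]; linarith
  have e2 : G - 1 / ((k : ℝ) + 1) ≤ f m ω / m := by rw [le_div_iff₀ hm]; linarith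
  constructor <;> linarith

section RandomSum

variable {Ω : Type*} {η : ℕ → ℕ → Ω → ℝ} {lam : ℕ → ℕ → Ω → ℕ}

lemma normalizedSum_eq (β : ℝ) (N m : ℕ) (ω : Ω) : normalizedSum η lam β N m ω =
    1 / (N : ℝ) * ∑ i ∈ Finset.range N, Real.exp (β * randomSum (fun x => x) η lam i m ω) := by
  simp only [normalizedSum, randomSum, Finset.mul_sum, Real.exp_sum]

lemma normalizedSum_eq_one_of_forall_eq_zero {ω : Ω} (h : ∀ i j, η i j ω = 0) (β : ℝ) {N : ℕ}
    (hN : 0 < N) (m : ℕ) : normalizedSum η lam β N m ω = 1 := by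
  simp [normalizedSum, h, hN.ne']

lemma hasUniformMGF_randomSum [MeasurableSpace Ω] {μ : Measure Ω} [IsProbabilityMeasure μ]
    {χ : ℝ → ℝ} {f : ℝ → ℝ} (hf : Measurable f)
    (hη : ∀ i j, Measurable (η i j))
    (hη_indep : iIndepFun (fun p : ℕ × ℕ => η p.1 p.2) μ)
    (hη_ident : ∀ i j, IdentDistrib (η i j) (η 0 0) μ μ)
    (hlam : ∀ i m, Measurable (lam i m))
    (hlam_ident : ∀ i m, IdentDistrib (lam i m) (lam 0 m) μ μ)
    (h_indep : IndepFun (fun ω (p : ℕ × ℕ) => η p.1 p.2 ω) (fun ω (p : ℕ × ℕ) => lam p.1 p.2 ω) μ)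
    (hχ : HasExponentialAsymptotics μ (fun m => lam 0 m) χ)
    {t : ℝ} (ht : t ∈ integrableExpSet (fun ω => f (η 0 0 ω)) μ)
    (hc : 0 ≤ cgf (fun ω => f (η 0 0 ω)) μ t) :
    HasUniformMGF μ (randomSum f η lam) t (χ (cgf (fun ω => f (η 0 0 ω)) μ t)) := by
  obtain ⟨r, hr, h⟩ := hχ.exists_tendsto hc
  refine ⟨r, hr, ?_⟩
  filter_upwards [h] with m hm i
  refine mem_integrableExpSet_of_lintegral (measurable_randomSum hf hη hlam i m).aemeasurable
    (Real.exp_pos _).le ?_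
  rw [lintegral_exp_randomSum hf hη hη_indep hη_ident hlam hlam_ident h_indep ht i m, hm]

end RandomSum

lemma constrainedInf_le {ν : ℝ → EReal} {β q x : ℝ} (hx : ν x ≤ (q : EReal)) :
    constrainedInf ν β q ≤ ν x - ((β * x : ℝ) : EReal) :=
  iInf₂_le (f := fun (x : ℝ) (_ : x ∈ {x : ℝ | ν x ≤ (q : EReal)}) =>
    ν x - ((β * x : ℝ) : EReal)) x hx

lemma constrainedInf_nonpos_of_cgf_eq_zero {Ω : Type*} [MeasurableSpace Ω] {μ : Measure Ω}
    {X : Ω → ℝ} {χ : ℝ → ℝ} (hχ : ∀ t, 0 ≤ t → t ≤ χ t) (hX : ∀ t, cgf X μ t = 0) {β q : ℝ}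
    (hq : 0 ≤ q) :
    constrainedInf (rateFunction (legendreTransform χ) (cramerTransform μ X)) β q ≤ 0 := by
  have h1 : rateFunction (legendreTransform χ) (cramerTransform μ X) 0 ≤ 0 := by
    refine (iInf₂_le 1 (Set.mem_Ioi.2 one_pos)).trans ?_
    have hψ : legendreTransform χ 1 ≤ 0 := iSup₂_le fun t ht => by
      rw [← EReal.coe_zero, EReal.coe_le_coe_iff]
      linarith [hχ t ht]
    have hφ : cramerTransform μ X (0 / 1) ≤ 0 := iSup₂_le fun t _ => by
      rw [← EReal.coe_zero, EReal.coe_le_coe_iff, hX]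
      simp
    simpa using add_le_add hψ hφ
  refine (constrainedInf_le (h1.trans (EReal.coe_nonneg.2 hq))).trans ?_
  simpa using h1

theorem theorem2p1 {Ω : Type*} [MeasurableSpace Ω] (μ : Measure Ω) [IsProbabilityMeasure μ]
    (η : ℕ → ℕ → Ω → ℝ) (lam : ℕ → ℕ → Ω → ℕ) (χ : ℝ → ℝ)
    -- the `η i j` are i.i.d. with mean zero and some finite positive exponential moment
    (hη_meas : ∀ i j, Measurable (η i j))
    (hη_indep : iIndepFun (fun p : ℕ × ℕ => η p.1 p.2) μ)
    (hη_ident : ∀ i j, IdentDistrib (η i j) (η 0 0) μ μ)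
    (hη_int : Integrable (η 0 0) μ)
    (hη_mean : ∫ ω, η 0 0 ω ∂μ = 0)
    (hη_exp : ∃ t : ℝ, 0 < t ∧ t ∈ integrableExpSet (η 0 0) μ)
    -- the `lam i m` are independent, with a law depending only on `m`, of mean `m`
    (hlam_meas : ∀ i m, Measurable (lam i m))
    (hlam_indep : iIndepFun (fun p : ℕ × ℕ => lam p.1 p.2) μ)
    (hlam_ident : ∀ i m, IdentDistrib (lam i m) (lam 0 m) μ μ)
    (hlam_int : ∀ m, Integrable (fun ω => (lam 0 m ω : ℝ)) μ)
    (hlam_mean : ∀ m, ∫ ω, (lam 0 m ω : ℝ) ∂μ = (m : ℝ))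
    (hlam_exp : HasExponentialAsymptotics μ (fun m => lam 0 m) χ)
    (hχ_diff : ∀ t : ℝ, 0 < t → DifferentiableAt ℝ χ t)
    -- the two families are independent of each other
    (h_indep : IndepFun (fun ω (p : ℕ × ℕ) => η p.1 p.2 ω) (fun ω (p : ℕ × ℕ) => lam p.1 p.2 ω) μ)
    (β q : ℝ) (hβ : 0 < β) (hq : 0 < q) :
    ∃ F : ℝ,
      (F : EReal) =
        constrainedInf (rateFunction (legendreTransform χ) (cramerTransform μ (η 0 0))) β q ∧
      ∀ᵐ ω ∂μ, Tendsto
        (fun m : ℕ => 1 / (β * (m : ℝ)) *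
          Real.log (normalizedSum η lam β ⌊Real.exp (q * (m : ℝ))⌋₊ m ω))
        atTop (𝓝 (-(1 / β * F))) := by
  have hL : ∀ m, Measurable (lam 0 m) := hlam_meas 0
  have hX := (hη_meas 0 0).aemeasurable (μ := μ)
  have hχ0 : χ 0 = 0 := hlam_exp.apply_zero hL
  have hχ_ge : ∀ t, 0 ≤ t → t ≤ χ t := fun t => hlam_exp.le_apply hL hlam_int hlam_mean
  have hχ_mono : ∀ s t, 0 ≤ s → s ≤ t → χ s ≤ χ t := fun s t => hlam_exp.mono hL
  have hχ_conv := hlam_exp.convexOn hL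
  have hc : ∀ t, 0 ≤ t → t ∈ integrableExpSet (η 0 0) μ → 0 ≤ cgf (η 0 0) μ t := by
    intro t _ hti
    have := mul_integral_le_cgf hη_int hti
    rwa [hη_mean, mul_zero] at this
  set G := sInf (freeEnergySet μ (η 0 0) χ β q) with hG
  have hbdd : BddBelow (freeEnergySet μ (η 0 0) χ β q) := bddBelow_freeEnergySet hχ_ge hq hc
  have hne : (freeEnergySet μ (η 0 0) χ β q).Nonempty := by
    obtain ⟨t, ht, hti⟩ := hη_exp
    exact ⟨_, min t β, ⟨lt_min ht hβ, min_le_right _ _,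
      mem_integrableExpSet_of_le (lt_min ht hβ).le (min_le_left _ _) hti⟩, rfl⟩
  have hupper : ∀ ε > 0, ∀ᵐ ω ∂μ, ∀ᶠ m : ℕ in atTop,
      Real.log (normalizedSum η lam β ⌊Real.exp (q * m)⌋₊ m ω) ≤ m * (G + ε) := by
    intro ε hε
    obtain ⟨_, ⟨t, ⟨ht, htβ, hti⟩, rfl⟩, hlt⟩ :=
      exists_lt_of_csInf_lt hne (show G < G + ε / 2 by linarith)
    have hmgf := hasUniformMGF_randomSum (f := fun x => x) measurable_id hη_meas hη_indep
      hη_ident hlam_meas hlam_ident h_indep hlam_exp hti (hc t ht.le hti)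
    filter_upwards [ae_eventually_log_sum_le ht htβ hq hmgf (half_pos hε)] with ω hω
    filter_upwards [hω] with m hm
    rw [normalizedSum_eq]
    refine hm.trans (mul_le_mul_of_nonneg_left ?_ (Nat.cast_nonneg m))
    simp only at hlt
    linarith
  obtain ⟨hinf, hlower⟩ : constrainedInf (rateFunction (legendreTransform χ)
        (cramerTransform μ (η 0 0))) β q ≤ ((-G : ℝ) : EReal) ∧
      ∀ ε > 0, ∀ᵐ ω ∂μ, ∀ᶠ m : ℕ in atTop,
        m * (G - ε) ≤ Real.log (normalizedSum η lam β ⌊Real.exp (q * m)⌋₊ m ω) := by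
    -- If `φ` vanishes at some `t > 0` then `η = 0` almost surely and the sum is identically one.
    -- This case is separate because `χ` need not be differentiable at `0`.
    by_cases hdeg : ∃ t, 0 < t ∧ t ∈ integrableExpSet (η 0 0) μ ∧ cgf (η 0 0) μ t ≤ 0
    · obtain ⟨t, ht, hti, hct⟩ := hdeg
      have hae := ae_eq_zero_of_cgf_eq_zero hη_int hη_mean hti ht.ne'
        (le_antisymm hct (hc t ht.le hti))
      have hcgf : ∀ s, cgf (η 0 0) μ s = 0 := fun s => by
        rw [cgf, mgf_congr hae, mgf_zero_fun]
        simp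
      have hβi : β ∈ integrableExpSet (η 0 0) μ := by
        refine (integrable_const (1 : ℝ)).congr ?_
        filter_upwards [hae] with ω hω
        simp [hω]
      have hG0 : G ≤ 0 := by
        refine csInf_le hbdd ⟨β, ⟨hβ, le_rfl, hβi⟩, ?_⟩
        simp [hcgf, hχ0, hβ.ne']
      refine ⟨(constrainedInf_nonpos_of_cgf_eq_zero hχ_ge hcgf hq.le).trans
        (EReal.coe_nonneg.2 (by linarith)), fun ε hε => ?_⟩
      have hall : ∀ᵐ ω ∂μ, ∀ i j, η i j ω = 0 := by
        refine ae_all_iff.2 fun i => ae_all_iff.2 fun j => ?_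
        exact (hη_ident i j).symm.ae_snd (p := fun x => x = 0) (measurableSet_singleton 0) hae
      filter_upwards [hall] with ω hω
      refine Eventually.of_forall fun m => ?_
      have hN : 0 < ⌊Real.exp (q * m)⌋₊ := Nat.floor_pos.2 (Real.one_le_exp (by positivity))
      rw [normalizedSum_eq_one_of_forall_eq_zero hω β hN, Real.log_one]
      exact mul_nonpos_of_nonneg_of_nonpos (Nat.cast_nonneg m) (by linarith)
    · push Not at hdeg
      have hpt := fun {ε : ℝ} (hε : 0 < ε) => exists_truncation_near_sInf hX hχ_mono hχ_ge
        hχ_diff hdeg hη_exp hβ hq hε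
      constructor
      · rw [← EReal.le_of_forall_lt_iff_le]
        intro z hz
        have hz' : -G < z := EReal.coe_lt_coe_iff.1 hz
        obtain ⟨M, t, ht, hpos, hI, hval⟩ := hpt (show 0 < z + G by linarith)
        have hν := rateFunction_le_of_truncation hX hχ_conv hχ0 hχ_ge ht hpos
          (hχ_diff _ hpos)
        refine (constrainedInf_le (hν.trans (EReal.coe_le_coe_iff.2 hI.le))).trans
          ((EReal.sub_le_sub hν le_rfl).trans ?_)
        rw [← EReal.coe_sub, EReal.coe_le_coe_iff]
        linarith
      · intro ε hε
        obtain ⟨M, t, ht, hpos, hI, hval⟩ := hpt (half_pos hε)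
        have hf : Measurable fun x : ℝ => min x M := measurable_id.min measurable_const
        have hΦ := differentiableAt_cgf_min hX M ht
        have hmgf : ∀ᶠ u in 𝓝 t, HasUniformMGF μ (randomSum (fun x => min x M) η lam) u
            (χ (cgf (fun ω => min (η 0 0 ω) M) μ u)) := by
          filter_upwards [hΦ.continuousAt.eventually (lt_mem_nhds hpos), lt_mem_nhds ht]
            with u hu hu0
          exact hasUniformMGF_randomSum hf hη_meas hη_indep hη_ident hlam_meas hlam_ident h_indep
            hlam_exp (mem_integrableExpSet_min hX M hu0.le) hu.le
        have hderiv := ((hχ_diff _ hpos).comp t hΦ).hasDerivAt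
        have hlow := ae_eventually_le_log_sum
          (fun i m => measurable_randomSum hf hη_meas hlam_meas i m)
          (fun m i k hik => indepFun_randomSum hf hη_meas hη_indep hlam_meas hlam_indep h_indep
            hik m) hβ ht hq hmgf hderiv hI (half_pos hε)
        filter_upwards [hlow] with ω hω
        filter_upwards [hω] with m hm
        have hN : 0 < ⌊Real.exp (q * m)⌋₊ := Nat.floor_pos.2 (Real.one_le_exp (by positivity))
        have hNr : (0 : ℝ) < ⌊Real.exp (q * m)⌋₊ := Nat.cast_pos.2 hN
        have h1 : (m : ℝ) * (G - ε) ≤ m * (β * deriv (fun u => χ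
            (cgf (fun ω => min (η 0 0 ω) M) μ u)) t - (t * deriv (fun u => χ
            (cgf (fun ω => min (η 0 0 ω) M) μ u)) t - χ (cgf (fun ω => min (η 0 0 ω) M) μ t))
              - ε / 2) :=
          mul_le_mul_of_nonneg_left (by linarith) (Nat.cast_nonneg m)
        refine h1.trans (hm.trans ?_)
        rw [normalizedSum_eq]
        refine Real.log_le_log (mul_pos (by positivity) (Finset.sum_pos
          (fun i _ => Real.exp_pos _) (Finset.nonempty_range_iff.2 hN.ne'))) ?_
        refine mul_le_mul_of_nonneg_left (Finset.sum_le_sum fun i _ => Real.exp_le_exp.2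
          (mul_le_mul_of_nonneg_left ?_ hβ.le)) (by positivity)
        -- Truncation lowers every summand, so the lower bound for truncated sums carries over.
        exact Finset.sum_le_sum fun j _ => min_le_left _ _
  refine ⟨-G, le_antisymm (neg_sInf_le_constrainedInf hne hc) hinf, ?_⟩
  filter_upwards [tendsto_div_of_ae_eventually_bounds hupper hlower] with ω hω
  have h1 := hω.const_mul (1 / β)
  rw [mul_neg, neg_neg]
  refine h1.congr fun m => ?_
  rw [one_div, one_div, mul_inv]
  ring
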